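/- **Model.** An instance of the submodular matroid secretary problem (SMSP) consists of a matroid $\mathcal M=(E,\mathcal I)$ on a finite ground set $E$ and a non-negative submodular function $f\colon 2^E\to\mathbb R_{\ge 0}$, i.e. $f(A\cup\{e\})-f(A)\ge f(B\cup\{e\})-f(B)$ for all $A\subseteq B\subseteq E$ and $e\in E\setminus B$. The elements of $E$ arrive in a uniformly random order, and a (possibly randomized) algorithm must irrevocably accept or reject each element upon its arrival. It knows $n=|E|$ in advance, and has access to a value oracle returning $f(S)$ and an independence oracle deciding $S\in\mathcal I$, both only for sets $S$ of elements that have already arrived. On every instance its set of accepted elements must always be independent. The matroid secretary problem (MSP) is the restriction to objectives $f(S)=w(S)=\sum_{u\in S}w(u)$ with non-negative weights $w$. An algorithm is $c$-competitive for SMSP (respectively MSP) on $\mathcal M$ if for every instance of the problem over $\mathcal M$ the expected value $\mathbb E[f(Q)]$ of its accepted set $Q$, over the arrival order and the internal randomness of the algorithm, satisfies $\max_{T\in\mathcal I} f(T)\le c\cdot\mathbb E[f(Q)]$. **Theorem.** Let $\mathsf{Linear}$ be an algorithm for MSP, and let $\alpha\ge 1$ and $q\in(0,1]$. Then there exists an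 algorithm for SMSP, depending only on $\mathsf{Linear}$, $\alpha$ and $q$, such that for every matroid $\mathcal M$ on which $\mathsf{Linear}$ - is $\alpha$-competitive for MSP, and - on every MSP instance over $\mathcal M$ selects every element with probability at most $q$, this algorithm is $24\alpha(3q\alpha+1)$-competitive for SMSP on $\mathcal M$. Moreover, if such a matroid $\mathcal M$ has at least one element that is not a loop, then $24\alpha(3q\alpha+1)\le 96\,q\alpha^2$, so that the competitive ratio is $O(q\alpha^2)$ with an absolute constant. -/

import Mathlib

universe u v

/-- A randomized online policy for ground sets with exactly `n` elements.  The policy draws a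
random seed `ω : Ω` once, independently of the arrival order, and is deterministic afterwards.
The elements have no visible names besides their position in the arrival order: the `j`-th
arriving element is `j`.  When element `i` arrives, the policy irrevocably accepts (`true`) or
rejects (`false`) it, knowing only `n`, the seed, and the answers of the independence oracle and
of the value oracle on all sets consisting of elements that have already arrived (that is, of the
elements `0, …, i`).  (Its own earlier decisions are functions of these data.) -/
structure OnlinePolicy (n : ℕ) where
  /-- the space of random seeds -/
  Ω : Type u
  [measurableSpace : MeasurableSpace Ω]
  /-- the distribution of the random seed -/
  law : MeasureTheory.Measure Ω
  [isProbabilityMeasure : MeasureTheory.IsProbabilityMeasure law]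
  /-- the decision about element `i` -/
  accept : (i : Fin n) → (ω : Ω) →
    (indep : Finset (Fin (i + 1)) → Prop) → (value : Finset (Fin (i + 1)) → ℝ) → Bool
  measurable_accept : ∀ i indep value, Measurable fun ω => accept i ω indep value

attribute [instance] OnlinePolicy.measurableSpace OnlinePolicy.isProbabilityMeasure

/-- An online algorithm: it is told the number `n` of elements before the first arrival, and has
no other prior information on the instance. -/
def OnlineAlgorithm : Type (u + 1) := (n : ℕ) → OnlinePolicy.{u} n

section Model

variable {E : Type v} [Fintype E] [DecidableEq E]

/-- An arrival order of the elements of `E`: `σ i` is the `i`-th arriving element. -/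
abbrev ArrivalOrder (E : Type v) [Fintype E] : Type v := Fin (Fintype.card E) ≃ E

/-- The set of elements whose positions in the arrival order are those in `S`, where all the
positions in `S` are at most `i`. -/
def arrivedSet (σ : ArrivalOrder E) (i : Fin (Fintype.card E)) (S : Finset (Fin (i + 1))) :
    Finset E :=
  S.map ((Fin.castLEEmb (Nat.succ_le_of_lt i.isLt)).trans σ.toEmbedding)

namespace OnlineAlgorithm

/-- The set of elements accepted by `A` on the instance with matroid `M` and objective `f`, for the
arrival order `σ` and the seed `ω`. -/
def output (A : OnlineAlgorithm.{u}) (M : Matroid E) (f : Finset E → ℝ) (σ : ArrivalOrder E)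
    (ω : (A (Fintype.card E)).Ω) : Finset E :=
  (Finset.univ.filter fun i =>
    (A (Fintype.card E)).accept i ω
      (fun S => M.Indep (arrivedSet σ i S : Set E))
      (fun S => f (arrivedSet σ i S)) = true).map σ.toEmbedding

/-- The expectation of `f (output)`, over a uniformly random arrival order and, independently, the
random seed. -/
noncomputable def expectedValue (A : OnlineAlgorithm.{u}) (M : Matroid E) (f : Finset E → ℝ) : ℝ :=
  (∑ σ : ArrivalOrder E,
    ∫ ω, f (A.output M f σ ω) ∂(A (Fintype.card E)).law) / Fintype.card (ArrivalOrder E)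

/-- The probability, over a uniformly random arrival order and, independently, the random seed,
that `A` accepts the element `e`. -/
noncomputable def selectionProb (A : OnlineAlgorithm.{u}) (M : Matroid E) (f : Finset E → ℝ)
    (e : E) : ℝ :=
  (∑ σ : ArrivalOrder E,
    (A (Fintype.card E)).law.real {ω | e ∈ A.output M f σ ω}) / Fintype.card (ArrivalOrder E)

end OnlineAlgorithm

/-- The linear set function `S ↦ ∑ e ∈ S, w e`. -/
def linearObjective (w : E → ℝ) (S : Finset E) : ℝ := ∑ e ∈ S, w e

/-- Non-negative submodular set functions (diminishing returns). -/
structure IsNonnegSubmodular (f : Finset E → ℝ) : Prop where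
  nonneg : ∀ S, 0 ≤ f S
  diminishing : ∀ A B : Finset E, A ⊆ B → ∀ e, e ∉ B →
    f (insert e B) - f B ≤ f (insert e A) - f A

namespace OnlineAlgorithm

/-- `A` is at least `c`-competitive on the instance `(M, f)`: its expected value is at least
`f(OPT) / c`, where `OPT` is an independent set maximizing `f`. -/
def CompetitiveOnInstance (A : OnlineAlgorithm.{u}) (M : Matroid E) (f : Finset E → ℝ)
    (c : ℝ) : Prop :=
  ∀ T : Finset E, M.Indep (T : Set E) → f T ≤ c * A.expectedValue M f

/-- `A` is at least `c`-competitive for the matroid secretary problem on `M`. -/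
def MSPCompetitive (A : OnlineAlgorithm.{u}) (M : Matroid E) (c : ℝ) : Prop :=
  ∀ w : E → ℝ, (∀ e, 0 ≤ w e) → A.CompetitiveOnInstance M (linearObjective w) c

/-- On every instance of the matroid secretary problem on `M`, the algorithm `A` selects every
element with probability at most `q`. -/
def MSPSelectionBound (A : OnlineAlgorithm.{u}) (M : Matroid E) (q : ℝ) : Prop :=
  ∀ w : E → ℝ, (∀ e, 0 ≤ w e) → ∀ e, A.selectionProb M (linearObjective w) e ≤ q

/-- `A` is at least `c`-competitive for the submodular matroid secretary problem on `M`. -/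
def SMSPCompetitive (A : OnlineAlgorithm.{u}) (M : Matroid E) (c : ℝ) : Prop :=
  ∀ f : Finset E → ℝ, IsNonnegSubmodular f → A.CompetitiveOnInstance M f c

end OnlineAlgorithm

end Model

/-- `A` is an algorithm for the matroid secretary problem: on every instance it always accepts an
independent set. -/
def IsMSPAlgorithm (A : OnlineAlgorithm.{u}) : Prop :=
  ∀ (E : Type v) [Fintype E] [DecidableEq E] (M : Matroid E), M.E = Set.univ →
    ∀ w : E → ℝ, (∀ e, 0 ≤ w e) → ∀ σ ω,
      M.Indep (A.output M (linearObjective w) σ ω : Set E)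

/-- `A` is an algorithm for the submodular matroid secretary problem: on every instance it always
accepts an independent set. -/
def IsSMSPAlgorithm (A : OnlineAlgorithm.{u}) : Prop :=
  ∀ (E : Type v) [Fintype E] [DecidableEq E] (M : Matroid E), M.E = Set.univ →
    ∀ f : Finset E → ℝ, IsNonnegSubmodular f → ∀ σ ω,
      M.Indep (A.output M f σ ω : Set E)

/-! The algorithm turns a submodular instance into a random linear one. Every element is sampled
with probability 1/2. A greedy process over all elements repeatedly considers the feasible element
of largest positive marginal with respect to the current solution. A sampled element joins the
solution. An unsampled one becomes active with probability `1/m`, its weight being that marginal,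
and is otherwise discarded; all other weights are 0. `Linear` runs on these weights, and its choices
of positive weight are accepted.

Online feasibility. Unsampled elements never alter the greedy solution, so the weight of an
unsampled element depends only on that element and the sample (`stage_restrict`). The sample can be
placed at the beginning of the real order while `Linear` sees a uniform order independent of the
weights: sampled elements weigh 0, so they need no decision and can be inserted at their simulated
positions (`output_reduction`, `expectedValue_reduction`).

Competitiveness. The state in which `u` is considered is independent of the coins of `u`. Hence any
sum over considered elements has, restricted to active ones, `1/m` times the expectation it has
restricted to sampled ones (`expect_fullTotal_swap`). Let `W` be the expected gain of the greedy
solution. Three estimates combine: (1) `f T ≤ 2 f ∅ + 6 W` for independent `T`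
(`val_le_greedyGain`): greedy gains dominate the marginals of `T`, and uniting `T` with a random set
that contains each element with probability at most 1/2 keeps half of `f T`. (2) The active elements
contain an independent set of expected weight at least `W/(m+1)` (`greedyGain_le_indep`), of which
`Linear` earns a `1/α` fraction. (3) Weights overestimate marginals, since accepted elements also
interact with each other. The total overestimate over active elements is at most `(2W + f
∅)/(m(m+1))` in expectation (`expect_loss_le`), and only a fraction `q` of it is suffered, because
`Linear` selects each element with probability at most `q`. The gain in (2) is of order `W/(mα)` and
the loss in (3) of order `qW/m²`, so `m` is taken of order `qα`. -/

namespace SubmodularSecretary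

/-- The data the greedy process runs on: an independence oracle, a value oracle, and a ranking of
the elements that breaks ties. -/
structure Oracle (A : Type*) where
  ind : Finset A → Prop
  val : Finset A → ℝ
  rank : A → ℕ

/-! ### The greedy process and its dependence on the sample. -/

section Greedy

variable {A : Type*} [DecidableEq A]

namespace Oracle

/-- `v` may be added to `S`: it is available, keeps independence and increases the value. -/
def Candidate (O : Oracle A) (S R : Finset A) (v : A) : Prop :=
  v ∈ R ∧ v ∉ S ∧ O.ind (insert v S) ∧ O.val S < O.val (insert v S)

/-- `v` is a candidate of maximum value, ties being broken by rank. -/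
def IsBest (O : Oracle A) (S R : Finset A) (v : A) : Prop :=
  O.Candidate S R v ∧ ∀ v', O.Candidate S R v' →
    toLex (O.val (insert v' S), O.rank v') ≤ toLex (O.val (insert v S), O.rank v)

open Classical in
/-- The element that the greedy algorithm with current solution `S` considers next, among the
elements of `R`. -/
noncomputable def next (O : Oracle A) (S R : Finset A) : Option A :=
  if h : ∃ v, O.IsBest S R v then some h.choose else none

theorem IsBest.unique {O : Oracle A} (hO : Function.Injective O.rank) {S R : Finset A} {v v' : A}
    (h : O.IsBest S R v) (h' : O.IsBest S R v') : v = v' := by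
  have := le_antisymm (h'.2 v h.1) (h.2 v' h'.1)
  exact hO (congrArg (fun z => (ofLex z).2) this)

theorem next_eq_some {O : Oracle A} (hO : Function.Injective O.rank) {S R : Finset A} {v : A} :
    O.next S R = some v ↔ O.IsBest S R v := by
  unfold next
  split_ifs with h
  · simp only [Option.some.injEq]
    exact ⟨fun e => e ▸ h.choose_spec, fun e => h.choose_spec.unique hO e⟩
  · simp only [false_iff]
    exact fun e => h ⟨v, e⟩

theorem next_eq_none {O : Oracle A} {S R : Finset A} :
    O.next S R = none ↔ ∀ v, ¬ O.Candidate S R v := by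
  classical
  unfold next
  split_ifs with h
  · simp only [false_iff, not_forall, not_not]
    exact ⟨_, h.choose_spec.1⟩
  · simp only [true_iff]
    intro v hv
    obtain ⟨b, hb, hmax⟩ := Finset.exists_max_image (R.filter fun v => O.Candidate S R v)
      (fun v => toLex (O.val (insert v S), O.rank v)) ⟨v, by simp [hv.1, hv]⟩
    simp only [Finset.mem_filter] at hb hmax
    exact h ⟨b, hb.2, fun v' hv' => hmax v' ⟨hv'.1, hv'⟩⟩

theorem IsBest.mono {O : Oracle A} {S R R' : Finset A} {v : A} (h : O.IsBest S R v)
    (hR : R' ⊆ R) (hv : v ∈ R') : O.IsBest S R' v :=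
  ⟨⟨hv, h.1.2⟩, fun v' hv' => h.2 v' ⟨hR hv'.1, hv'.2⟩⟩

theorem IsBest.val_le {O : Oracle A} {S R : Finset A} {v v' : A} (h : O.IsBest S R v)
    (h' : O.Candidate S R v') : O.val (insert v' S) ≤ O.val (insert v S) := by
  rcases Prod.Lex.le_iff.1 (h.2 v' h') with h | h
  · exact h.le
  · exact h.1.le

/-- The greedy solution at the moment when `u` is considered, if it is considered at all, in the
greedy process that starts from `S`, considers elements of `R`, and adds a considered element `v`
to the solution if `l v` holds. -/
noncomputable def stage (O : Oracle A) (l : A → Bool) :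
    ℕ → Finset A → Finset A → A → Option (Finset A)
  | 0, _, _, _ => none
  | k + 1, S, R, u =>
    match O.next S R with
    | none => none
    | some v =>
      if v = u then some S else O.stage l k (if l v then insert v S else S) (R.erase v) u

theorem stage_of_next_eq_none {O : Oracle A} {l : A → Bool} {S R : Finset A}
    (h : O.next S R = none) (k : ℕ) (u : A) : O.stage l k S R u = none := by
  cases k with
  | zero => rfl
  | succ k => simp [stage, h]

theorem stage_succ {O : Oracle A} {l : A → Bool} {S R : Finset A} {v : A}
    (h : O.next S R = some v) (k : ℕ) (u : A) : O.stage l (k + 1) S R u =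
      if v = u then some S else O.stage l k (if l v then insert v S else S) (R.erase v) u := by
  simp [stage, h]

/-- Whether and when `u` is considered depends only on the elements that may enter the
solution. -/
theorem stage_restrict {O : Oracle A} (hO : Function.Injective O.rank) {l : A → Bool} {u : A}
    (hu : l u = false) :
    ∀ (k k' : ℕ) (S R : Finset A), u ∈ R → R.card ≤ k → (R.filter fun v => l v).card < k' →
      O.stage l k S R u = O.stage l k' S (insert u (R.filter fun v => l v)) u := by
  intro k
  induction k with
  | zero =>
    intro k' S R huR hk
    simp only [Nat.le_zero, Finset.card_eq_zero] at hk
    simp [hk] at huR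
  | succ k ih =>
    intro k' S R huR hk hk'
    have hsub : insert u (R.filter fun v => l v) ⊆ R :=
      Finset.insert_subset huR (Finset.filter_subset _ _)
    cases hn : O.next S R with
    | none =>
      rw [stage_of_next_eq_none hn, stage_of_next_eq_none]
      rw [next_eq_none] at hn ⊢
      exact fun v hv => hn v ⟨hsub hv.1, hv.2⟩
    | some v =>
      rw [stage_succ hn]
      have hb := (next_eq_some hO).1 hn
      by_cases hvu : v = u
      · subst hvu
        have := (next_eq_some hO).2 (hb.mono hsub (Finset.mem_insert_self _ _))
        cases k' with
        | zero => omega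
        | succ k' => rw [stage_succ this]; simp
      · have hcard := Finset.card_erase_of_mem hb.1.1
        have huR' : u ∈ R.erase v := Finset.mem_erase.2 ⟨Ne.symm hvu, huR⟩
        rw [if_neg hvu]
        cases hl : l v with
        | true =>
          have hmem : v ∈ R.filter fun v => l v := by simp [hb.1.1, hl]
          have := (next_eq_some hO).2 (hb.mono hsub (Finset.mem_insert_of_mem hmem))
          have hE : (R.erase v).filter (fun v => l v) = (R.filter fun v => l v).erase v := by
            ext a; simp only [Finset.mem_filter, Finset.mem_erase]; tauto
          cases k' with
          | zero => omega
          | succ k' =>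
            rw [stage_succ this, if_neg hvu, ih k' _ _ huR' (by omega)
              (by rw [hE, Finset.card_erase_of_mem hmem]; have := Finset.card_pos.2 ⟨v, hmem⟩; omega)]
            rw [hE, Finset.erase_insert_of_ne (Ne.symm hvu), hl]
        -- A discarded element uses a step on the left only, so the two step bounds must vary
        -- independently.
        | false =>
          have hE : (R.erase v).filter (fun v => l v) = R.filter fun v => l v := by
            ext a
            simp only [Finset.mem_filter, Finset.mem_erase]
            constructor
            · tauto
            · rintro ⟨h1, h2⟩
              exact ⟨⟨by rintro rfl; simp [hl] at h2, h1⟩, h2⟩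
          rw [ih k' _ _ huR' (by omega) (by rw [hE]; exact hk'), hE]
          simp

/-! ### Invariance of the greedy process under embeddings. -/

section Transport

variable {B : Type*} [DecidableEq B]

theorem candidate_map {O : Oracle A} {O' : Oracle B} (φ : A ↪ B)
    (hind : ∀ S, O.ind S ↔ O'.ind (S.map φ)) (hval : ∀ S, O.val S = O'.val (S.map φ))
    {S R : Finset A} {v : A} :
    O'.Candidate (S.map φ) (R.map φ) (φ v) ↔ O.Candidate S R v := by
  simp [Candidate, hind, hval, Finset.map_insert]

theorem isBest_map {O : Oracle A} {O' : Oracle B} (φ : A ↪ B)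
    (hind : ∀ S, O.ind S ↔ O'.ind (S.map φ)) (hval : ∀ S, O.val S = O'.val (S.map φ))
    (hrank : ∀ a, O.rank a = O'.rank (φ a)) {S R : Finset A} {v : A} :
    O'.IsBest (S.map φ) (R.map φ) (φ v) ↔ O.IsBest S R v := by
  unfold IsBest
  rw [candidate_map φ hind hval]
  refine and_congr_right fun _ => ⟨fun h v' hv' => ?_, fun h b hb => ?_⟩
  · have := h (φ v') ((candidate_map φ hind hval).2 hv')
    simpa [hval, hrank, Finset.map_insert] using this
  · obtain ⟨v', -, rfl⟩ := Finset.mem_map.1 hb.1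
    have := h v' ((candidate_map φ hind hval).1 hb)
    simpa [hval, hrank, Finset.map_insert] using this

theorem next_map {O : Oracle A} {O' : Oracle B} (φ : A ↪ B)
    (hind : ∀ S, O.ind S ↔ O'.ind (S.map φ)) (hval : ∀ S, O.val S = O'.val (S.map φ))
    (hrank : ∀ a, O.rank a = O'.rank (φ a)) (hO' : Function.Injective O'.rank)
    (S R : Finset A) : O'.next (S.map φ) (R.map φ) = (O.next S R).map φ := by
  have hO : Function.Injective O.rank := fun a b h => φ.injective (hO' (by rw [← hrank, ← hrank, h]))
  cases h : O.next S R with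
  | none =>
    rw [Option.map_none, next_eq_none]
    intro b hb
    obtain ⟨v', -, rfl⟩ := Finset.mem_map.1 hb.1
    exact next_eq_none.1 h v' ((candidate_map φ hind hval).1 hb)
  | some v =>
    rw [Option.map_some, next_eq_some hO', isBest_map φ hind hval hrank]
    exact (next_eq_some hO).1 h

theorem stage_map {O : Oracle A} {O' : Oracle B} (φ : A ↪ B)
    (hind : ∀ S, O.ind S ↔ O'.ind (S.map φ)) (hval : ∀ S, O.val S = O'.val (S.map φ))
    (hrank : ∀ a, O.rank a = O'.rank (φ a)) (hO' : Function.Injective O'.rank)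
    {l : A → Bool} {l' : B → Bool} (hl : ∀ a, l a = l' (φ a)) (u : A) :
    ∀ (k : ℕ) (S R : Finset A), O'.stage l' k (S.map φ) (R.map φ) (φ u) =
      (O.stage l k S R u).map (Finset.map φ) := by
  intro k
  induction k with
  | zero => intro S R; rfl
  | succ k ih =>
    intro S R
    have hn := next_map φ hind hval hrank hO' S R
    cases h : O.next S R with
    | none =>
      rw [h, Option.map_none] at hn
      rw [stage_of_next_eq_none hn, stage_of_next_eq_none h, Option.map_none]
    | some v =>
      rw [h, Option.map_some] at hn
      rw [stage_succ hn, stage_succ h]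
      by_cases hvu : v = u
      · simp [hvu]
      · rw [if_neg hvu, if_neg (fun e => hvu (φ.injective e)), ← ih, ← hl, ← Finset.map_erase]
        congr 1
        split_ifs <;> simp [Finset.map_insert]

end Transport

/-- The marginal value of `u` at the moment when it is considered (zero if it never is). -/
noncomputable def gain (O : Oracle A) (l : A → Bool) (k : ℕ) (R : Finset A) (u : A) : ℝ :=
  (O.stage l k ∅ R u).elim 0 fun S => O.val (insert u S) - O.val S

/-- This makes weights computable online: the sample and `u` itself suffice. The same bound `k`
serves on both sides because `u` is missing from the filtered set, which is therefore strictly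
smaller than `R`. -/
theorem gain_restrict {O : Oracle A} (hO : Function.Injective O.rank) {l : A → Bool} {u : A}
    (hu : l u = false) {k : ℕ} {R : Finset A} (huR : u ∈ R) (hk : R.card ≤ k) :
    O.gain l k R u = O.gain l k (insert u (R.filter fun v => l v)) u := by
  unfold gain
  rw [stage_restrict hO hu k k ∅ R huR hk]
  refine lt_of_lt_of_le (Finset.card_lt_card ?_) hk
  refine Finset.ssubset_iff_subset_ne.2 ⟨Finset.filter_subset _ _, fun h => ?_⟩
  rw [← h] at huR
  simp [hu] at huR

theorem gain_map {B : Type*} [DecidableEq B] {O : Oracle A} {O' : Oracle B} (φ : A ↪ B)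
    (hind : ∀ S, O.ind S ↔ O'.ind (S.map φ)) (hval : ∀ S, O.val S = O'.val (S.map φ))
    (hrank : ∀ a, O.rank a = O'.rank (φ a)) (hO' : Function.Injective O'.rank)
    {l : A → Bool} {l' : B → Bool} (hl : ∀ a, l a = l' (φ a)) (u : A) (k : ℕ) (R : Finset A) :
    O'.gain l' k (R.map φ) (φ u) = O.gain l k R u := by
  have := stage_map φ hind hval hrank hO' hl u k ∅ R
  rw [Finset.map_empty] at this
  unfold gain
  rw [this]
  cases O.stage l k ∅ R u <;> simp [hval, Finset.map_insert]

theorem gain_nonneg {O : Oracle A} (hO : Function.Injective O.rank) (l : A → Bool) (k : ℕ)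
    (R : Finset A) (u : A) : 0 ≤ O.gain l k R u := by
  unfold gain
  generalize (∅ : Finset A) = S
  induction k generalizing S R with
  | zero => simp [stage]
  | succ k ih =>
    cases hn : O.next S R with
    | none => rw [stage_of_next_eq_none hn]; simp
    | some v =>
      rw [stage_succ hn]
      split_ifs with hvu <;> try exact ih _ _
      subst hvu
      simpa using ((next_eq_some hO).1 hn).1.2.2.2.le

end Oracle

end Greedy

/-! ### The greedy process with active elements, and telescoping sums along it. -/

/-- A state of the greedy process with sampling: the greedy solution `sol`, the set `act` of
considered active elements, an independent subset `indep` of `act`, and the set `rest` of elements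
not yet considered. -/
structure State (A : Type*) where
  sol : Finset A
  act : Finset A
  indep : Finset A
  rest : Finset A

section Visit

variable {A : Type*} [DecidableEq A]

open Classical in
/-- The element `v` is considered: it joins the solution if `l v`, and otherwise it becomes active
if `a v`, and is discarded if not. -/
noncomputable def State.step (O : Oracle A) (l a : A → Bool) (v : A) (s : State A) : State A where
  sol := if l v then insert v s.sol else s.sol
  act := if l v = false ∧ a v then insert v s.act else s.act
  indep := if (l v = false ∧ a v) ∧ O.ind (insert v s.indep) then insert v s.indep else s.indep
  rest := s.rest.erase v

/-- The state at the moment when `u` is considered. -/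
noncomputable def visit (O : Oracle A) (l a : A → Bool) : ℕ → State A → A → Option (State A)
  | 0, _, _ => none
  | k + 1, s, u =>
    match O.next s.sol s.rest with
    | none => none
    | some v => if v = u then some s else visit O l a k (s.step O l a v) u

/-- The state at the end of the process. -/
noncomputable def final (O : Oracle A) (l a : A → Bool) : ℕ → State A → State A
  | 0, s => s
  | k + 1, s =>
    match O.next s.sol s.rest with
    | none => s
    | some v => final O l a k (s.step O l a v)

/-- The sum of `F` over all considered elements and the states they are considered in. -/
noncomputable def total (O : Oracle A) (l a : A → Bool) (k : ℕ) (s : State A)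
    (F : A → State A → ℝ) : ℝ :=
  ∑ u ∈ s.rest, (visit O l a k s u).elim 0 (F u)

variable {O : Oracle A} {l a : A → Bool}

theorem visit_of_next_eq_none {s : State A} (h : O.next s.sol s.rest = none) (k : ℕ) (u : A) :
    visit O l a k s u = none := by
  cases k with
  | zero => rfl
  | succ k => simp [visit, h]

theorem visit_succ {s : State A} {v : A} (h : O.next s.sol s.rest = some v) (k : ℕ) (u : A) :
    visit O l a (k + 1) s u = if v = u then some s else visit O l a k (s.step O l a v) u := by
  simp [visit, h]

theorem final_of_next_eq_none {s : State A} (h : O.next s.sol s.rest = none) (k : ℕ) :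
    final O l a k s = s := by
  cases k with
  | zero => rfl
  | succ k => simp [final, h]

theorem final_succ {s : State A} {v : A} (h : O.next s.sol s.rest = some v) (k : ℕ) :
    final O l a (k + 1) s = final O l a k (s.step O l a v) := by
  simp [final, h]

theorem total_of_next_eq_none {s : State A} (h : O.next s.sol s.rest = none) (k : ℕ)
    (F : A → State A → ℝ) : total O l a k s F = 0 := by
  simp [total, visit_of_next_eq_none h]

theorem total_succ {s : State A} {v : A} (h : O.next s.sol s.rest = some v) (hv : v ∈ s.rest)
    (k : ℕ) (F : A → State A → ℝ) :
    total O l a (k + 1) s F = F v s + total O l a k (s.step O l a v) F := by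
  unfold total
  rw [← Finset.add_sum_erase _ _ hv, visit_succ h]
  congr 1
  · simp
  · refine Finset.sum_congr rfl fun u hu => ?_
    rw [visit_succ h, if_neg (Finset.ne_of_mem_erase hu).symm]

theorem next_eq_none_of_card_le_zero {s : State A} (h : s.rest.card ≤ 0) :
    O.next s.sol s.rest = none := by
  simp only [Nat.le_zero, Finset.card_eq_zero] at h
  rw [Oracle.next_eq_none]
  intro v hv
  simpa [h] using hv.1

/-- Induction along the process. -/
theorem process_induction (hO : Function.Injective O.rank) (l a : A → Bool)
    {P : ℕ → State A → Prop}
    (halt : ∀ k s, O.next s.sol s.rest = none → P k s)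
    (step : ∀ k s v, O.next s.sol s.rest = some v → O.IsBest s.sol s.rest v →
      P k (s.step O l a v) → P (k + 1) s) :
    ∀ k s, s.rest.card ≤ k → P k s := by
  intro k
  induction k with
  | zero => exact fun s hs => halt _ _ (next_eq_none_of_card_le_zero hs)
  | succ k ih =>
    intro s hs
    cases hn : O.next s.sol s.rest with
    | none => exact halt _ _ hn
    | some v =>
      have hb := (Oracle.next_eq_some hO).1 hn
      refine step k s v hn hb (ih _ ?_)
      have := Finset.card_erase_of_mem hb.1.1
      change (s.rest.erase v).card ≤ k
      omega

/-- The coins of `u` are read only after `u` has been considered. This is the source of all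
independence arguments below. -/
theorem visit_congr {l' a' : A → Bool} {u : A} (h : ∀ v, v ≠ u → l v = l' v ∧ a v = a' v) (k : ℕ)
    (s : State A) : visit O l a k s u = visit O l' a' k s u := by
  induction k generalizing s with
  | zero => rfl
  | succ k ih =>
    cases hn : O.next s.sol s.rest with
    | none => rw [visit_of_next_eq_none hn, visit_of_next_eq_none hn]
    | some v =>
      rw [visit_succ hn, visit_succ hn]
      split_ifs with hv
      · rfl
      · rw [ih]
        unfold State.step
        rw [(h v hv).1, (h v hv).2]

theorem visit_map_sol (k : ℕ) (s : State A) (u : A) :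
    (visit O l a k s u).map State.sol = O.stage l k s.sol s.rest u := by
  induction k generalizing s with
  | zero => rfl
  | succ k ih =>
    cases hn : O.next s.sol s.rest with
    | none => rw [visit_of_next_eq_none hn, Oracle.stage_of_next_eq_none hn]; rfl
    | some v =>
      rw [visit_succ hn, Oracle.stage_succ hn]
      split_ifs with hv hl
      · rfl
      · exact (ih _).trans (by simp [State.step, hl])
      · exact (ih _).trans (by simp [State.step, hl])

/-- The solution is a function of the sample alone, so the marks can be averaged with the solution
held fixed. -/
theorem final_sol_congr {a' : A → Bool} (k : ℕ) (s s' : State A) (h : s.sol = s'.sol)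
    (h' : s.rest = s'.rest) : (final O l a k s).sol = (final O l a' k s').sol := by
  induction k generalizing s s' with
  | zero => exact h
  | succ k ih =>
    cases hn : O.next s.sol s.rest with
    | none => rw [final_of_next_eq_none hn, final_of_next_eq_none (by rw [← h, ← h', hn]), h]
    | some v =>
      rw [final_succ hn, final_succ (v := v) (by rw [← h, ← h', hn])]
      exact ih _ _ (by simp [State.step, h]) (by simp [State.step, h'])

theorem mem_final_sol {e : A} (k : ℕ) (s : State A) (h : e ∈ (final O l a k s).sol) :
    e ∈ s.sol ∨ l e := by
  induction k generalizing s with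
  | zero => exact Or.inl h
  | succ k ih =>
    cases hn : O.next s.sol s.rest with
    | none => rw [final_of_next_eq_none hn] at h; exact Or.inl h
    | some v =>
      rw [final_succ hn] at h
      refine (ih _ h).elim (fun h => ?_) Or.inr
      simp only [State.step] at h
      split_ifs at h with hl
      · rcases Finset.mem_insert.1 h with rfl | h
        · exact Or.inr hl
        · exact Or.inl h
      · exact Or.inl h

theorem sol_subset_final (k : ℕ) (s : State A) : s.sol ⊆ (final O l a k s).sol := by
  induction k generalizing s with
  | zero => exact Finset.Subset.refl _
  | succ k ih =>
    cases hn : O.next s.sol s.rest with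
    | none => rw [final_of_next_eq_none hn]
    | some v =>
      rw [final_succ hn]
      refine Finset.Subset.trans ?_ (ih _)
      simp only [State.step]
      split_ifs
      · exact Finset.subset_insert _ _
      · exact Finset.Subset.refl _

theorem mem_final_act {e : A} (k : ℕ) (s : State A) (h : e ∈ (final O l a k s).act) :
    e ∈ s.act ∨ a e := by
  induction k generalizing s with
  | zero => exact Or.inl h
  | succ k ih =>
    cases hn : O.next s.sol s.rest with
    | none => rw [final_of_next_eq_none hn] at h; exact Or.inl h
    | some v =>
      rw [final_succ hn] at h
      refine (ih _ h).elim (fun h => ?_) Or.inr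
      simp only [State.step] at h
      split_ifs at h with hl
      · rcases Finset.mem_insert.1 h with rfl | h
        · exact Or.inr hl.2
        · exact Or.inl h
      · exact Or.inl h

theorem total_add (k : ℕ) (s : State A) (F G : A → State A → ℝ) :
    total O l a k s (fun u t => F u t + G u t) = total O l a k s F + total O l a k s G := by
  unfold total
  rw [← Finset.sum_add_distrib]
  refine Finset.sum_congr rfl fun u _ => ?_
  cases visit O l a k s u <;> simp

theorem total_sub (k : ℕ) (s : State A) (F G : A → State A → ℝ) :
    total O l a k s (fun u t => F u t - G u t) = total O l a k s F - total O l a k s G := by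
  unfold total
  rw [← Finset.sum_sub_distrib]
  refine Finset.sum_congr rfl fun u _ => ?_
  cases visit O l a k s u <;> simp

theorem val_final_sol (hO : Function.Injective O.rank) (k : ℕ) (s : State A)
    (hs : s.rest.card ≤ k) : O.val (final O l a k s).sol = O.val s.sol +
      total O l a k s (fun u t => if l u then O.val (insert u t.sol) - O.val t.sol else 0) := by
  refine process_induction hO l a (P := fun k s => O.val (final O l a k s).sol = O.val s.sol +
      total O l a k s (fun u t => if l u then O.val (insert u t.sol) - O.val t.sol else 0))
    (fun k s hn => ?_) (fun k s v hn hb ih => ?_) k s hs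
  · rw [final_of_next_eq_none hn, total_of_next_eq_none hn, add_zero]
  · rw [final_succ hn, total_succ hn hb.1.1, ih]
    simp only [State.step]
    split_ifs <;> ring

/-- Telescoping: sampled and active elements both enter the union, and discarded ones leave it
unchanged. -/
theorem val_final_union (hO : Function.Injective O.rank) (k : ℕ) (s : State A)
    (hs : s.rest.card ≤ k) : O.val ((final O l a k s).sol ∪ (final O l a k s).act) =
      O.val (s.sol ∪ s.act) + total O l a k s (fun u t => if l u ∨ a u then
        O.val (insert u (t.sol ∪ t.act)) - O.val (t.sol ∪ t.act) else 0) := by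
  refine process_induction hO l a (P := fun k s =>
      O.val ((final O l a k s).sol ∪ (final O l a k s).act) =
      O.val (s.sol ∪ s.act) + total O l a k s (fun u t => if l u ∨ a u then
        O.val (insert u (t.sol ∪ t.act)) - O.val (t.sol ∪ t.act) else 0))
    (fun k s hn => ?_) (fun k s v hn hb ih => ?_) k s hs
  · rw [final_of_next_eq_none hn, total_of_next_eq_none hn, add_zero]
  · rw [final_succ hn, total_succ hn hb.1.1, ih]
    simp only [State.step]
    cases hl : l v <;> cases ha : a v <;>
      simp [Finset.insert_union, Finset.union_insert] <;> ring

theorem sum_final_indep (hO : Function.Injective O.rank) (w : A → ℝ) (k : ℕ) (s : State A)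
    (hs : s.rest.card ≤ k) (hdisj : Disjoint s.rest s.indep) :
    ∑ u ∈ (final O l a k s).indep, w u = ∑ u ∈ s.indep, w u + total O l a k s (fun u t =>
      open Classical in
      if (l u = false ∧ a u) ∧ O.ind (insert u t.indep) then w u else 0) := by
  classical
  refine process_induction hO l a (P := fun k s => Disjoint s.rest s.indep →
      ∑ u ∈ (final O l a k s).indep, w u = ∑ u ∈ s.indep, w u + total O l a k s (fun u t =>
      if (l u = false ∧ a u) ∧ O.ind (insert u t.indep) then w u else 0))
    (fun k s hn _ => ?_) (fun k s v hn hb ih hd => ?_) k s hs hdisj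
  · rw [final_of_next_eq_none hn, total_of_next_eq_none hn, add_zero]
  · have hvI : v ∉ s.indep := Finset.disjoint_left.1 hd hb.1.1
    have hd' : Disjoint (s.rest.erase v) s.indep := hd.mono_left (Finset.erase_subset _ _)
    rw [final_succ hn, total_succ hn hb.1.1]
    by_cases h : (l v = false ∧ a v) ∧ O.ind (insert v s.indep)
    · have hst : (s.step O l a v).indep = insert v s.indep := if_pos h
      rw [ih (by rw [hst, Finset.disjoint_insert_right]; exact ⟨Finset.notMem_erase _ _, hd'⟩),
        hst, if_pos h, Finset.sum_insert hvI]
      ring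
    · have hst : (s.step O l a v).indep = s.indep := if_neg h
      rw [ih (by rw [hst]; exact hd'), hst, if_neg h, zero_add]

theorem ind_final_indep (k : ℕ) (s : State A) (hs : O.ind s.indep) :
    O.ind (final O l a k s).indep := by
  induction k generalizing s with
  | zero => exact hs
  | succ k ih =>
    cases hn : O.next s.sol s.rest with
    | none => rw [final_of_next_eq_none hn]; exact hs
    | some v =>
      rw [final_succ hn]
      refine ih _ ?_
      simp only [State.step]
      split_ifs with h
      · exact h.2
      · exact hs

end Visit

/-! ### Marginals of submodular functions. -/

section Submodular

variable {E : Type v} [DecidableEq E] {f : Finset E → ℝ}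

theorem marginal_anti (hf : IsNonnegSubmodular f) {A B : Finset E} (h : A ⊆ B) {e : E}
    (he : e ∉ B) : f (insert e B) - f B ≤ f (insert e A) - f A :=
  hf.diminishing A B h e he

/-- The value gained by adding the set `T` is at most the sum of the marginals. -/
theorem union_le_add_sum (hf : IsNonnegSubmodular f) (S T : Finset E) :
    f (T ∪ S) ≤ f S + ∑ t ∈ T, (f (insert t S) - f S) := by
  induction T using Finset.induction_on with
  | empty => simp
  | insert t T ht ih =>
    rw [Finset.sum_insert ht, Finset.insert_union]
    by_cases htS : t ∈ S
    · rw [Finset.insert_eq_of_mem (Finset.mem_union_right _ htS), Finset.insert_eq_of_mem htS]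
      linarith
    · have := marginal_anti hf (Finset.subset_union_right : S ⊆ T ∪ S) (e := t) (by simp [ht, htS])
      linarith

end Submodular

/-! ### Exchange arguments along the greedy process. -/

section Matroid

variable {E : Type v} [DecidableEq E]

/-- The oracle of a matroid, an objective and a ranking. -/
def oracle (M : Matroid E) (f : Finset E → ℝ) (rk : E → ℕ) : Oracle E where
  ind S := M.Indep (S : Set E)
  val := f
  rank := rk

/-- By augmentation. It keeps the slack terms in the charging arguments below non-negative. -/
theorem card_le_of_forall_dep {M : Matroid E} {I J : Finset E} (hI : M.Indep (I : Set E))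
    (hJ : M.Indep (J : Set E)) (h : ∀ e ∈ J, e ∉ I ∧ ¬ M.Indep (insert e I : Finset E)) :
    J.card ≤ I.card := by
  by_contra hlt
  push Not at hlt
  obtain ⟨e, he, hi⟩ := hI.augment hJ (by
    rw [Set.encard_coe_eq_coe_finsetCard, Set.encard_coe_eq_coe_finsetCard]
    exact_mod_cast hlt)
  refine (h e he.1).2 ?_
  rwa [Finset.coe_insert]

variable {M : Matroid E} {f : Finset E → ℝ} {rk : E → ℕ} {l a : E → Bool}

/-- The value of the elements of the solution that `indep` spans is at most the value of the
elements of `indep`. -/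
theorem total_dep_le (hrk : Function.Injective rk) (hf : IsNonnegSubmodular f) (k : ℕ)
    (s : State E) (hs : s.rest.card ≤ k) : ∀ (J : Finset E) (G : ℝ), 0 ≤ G →
      M.Indep (s.sol : Set E) → M.Indep (s.indep : Set E) → Disjoint s.rest s.sol →
      Disjoint s.rest s.indep → J ⊆ s.sol →
      (∀ e ∈ J, e ∉ s.indep ∧ ¬ M.Indep (insert e s.indep : Finset E)) →
      (∀ v, (oracle M f rk).Candidate s.sol s.rest v → f (insert v s.sol) - f s.sol ≤ G) →
      open Classical in
      total (oracle M f rk) l a k s (fun u t => if l u ∧ ¬ M.Indep (insert u t.indep : Finset E)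
        then f (insert u t.sol) - f t.sol else 0) ≤
      total (oracle M f rk) l a k s (fun u t =>
        if (l u = false ∧ a u) ∧ M.Indep (insert u t.indep : Finset E)
        then f (insert u t.sol) - f t.sol else 0) + G * (s.indep.card - J.card) := by
  -- A summation by parts in inductive form. `J` collects the solution elements already charged, all
  -- spanned by `indep`, so `|J| ≤ |indep|`. `G` bounds every current marginal. Marginals decrease
  -- along the process, so each unit of the slack `|indep| - |J|` can pay for one later spanned
  -- element.
  classical
  refine process_induction (O := oracle M f rk) hrk l a (P := fun k s => ∀ (J : Finset E) (G : ℝ),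
      0 ≤ G →
      M.Indep (s.sol : Set E) → M.Indep (s.indep : Set E) → Disjoint s.rest s.sol →
      Disjoint s.rest s.indep → J ⊆ s.sol →
      (∀ e ∈ J, e ∉ s.indep ∧ ¬ M.Indep (insert e s.indep : Finset E)) →
      (∀ v, (oracle M f rk).Candidate s.sol s.rest v → f (insert v s.sol) - f s.sol ≤ G) →
      total (oracle M f rk) l a k s (fun u t => if l u ∧ ¬ M.Indep (insert u t.indep : Finset E)
        then f (insert u t.sol) - f t.sol else 0) ≤
      total (oracle M f rk) l a k s (fun u t =>
        if (l u = false ∧ a u) ∧ M.Indep (insert u t.indep : Finset E)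
        then f (insert u t.sol) - f t.sol else 0) + G * (s.indep.card - J.card))
    (fun k s hn J G hG hM hI _ _ hJM hJ _ => ?_)
    (fun k s v hn hb ih J G hG hM hI hdM hdI hJM hJ hmax => ?_) k s hs
  · have hc : (J.card : ℝ) ≤ s.indep.card := by
      exact_mod_cast card_le_of_forall_dep hI (hM.subset (by exact_mod_cast hJM)) hJ
    rw [total_of_next_eq_none hn, total_of_next_eq_none hn, zero_add]
    exact mul_nonneg hG (by linarith)
  · have hc : (J.card : ℝ) ≤ s.indep.card := by
      exact_mod_cast card_le_of_forall_dep hI (hM.subset (by exact_mod_cast hJM)) hJ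
    have hvM : v ∉ s.sol := Finset.disjoint_left.1 hdM hb.1.1
    have hvI : v ∉ s.indep := Finset.disjoint_left.1 hdI hb.1.1
    have hMv : M.Indep (insert v s.sol : Finset E) := hb.1.2.2.1
    have hlt : f s.sol < f (insert v s.sol) := hb.1.2.2.2
    have hgG := hmax v hb.1
    set g := f (insert v s.sol) - f s.sol with hg
    have hGd : g * (s.indep.card - J.card) ≤ G * (s.indep.card - J.card) :=
      mul_le_mul_of_nonneg_right hgG (by linarith)
    have hdM' : Disjoint (s.rest.erase v) s.sol := hdM.mono_left (Finset.erase_subset _ _)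
    have hdI' : Disjoint (s.rest.erase v) s.indep := hdI.mono_left (Finset.erase_subset _ _)
    have hmax' : ∀ v', (oracle M f rk).Candidate s.sol (s.rest.erase v) v' →
        f (insert v' s.sol) - f s.sol ≤ g := by
      intro v' hv'
      have := hb.val_le (v' := v') ⟨Finset.mem_of_mem_erase hv'.1, hv'.2⟩
      simp only [oracle] at this
      linarith
    rw [total_succ hn hb.1.1, total_succ hn hb.1.1]
    cases hl : l v with
    | true =>
      have hst : (s.step (oracle M f rk) l a v) =
          ⟨insert v s.sol, s.act, s.indep, s.rest.erase v⟩ := by simp [State.step, hl]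
      rw [hst] at ih ⊢
      -- Enlarging the solution only lowers marginals and removes candidates, so `g` remains an
      -- upper bound.
      have hmax2 : ∀ v', (oracle M f rk).Candidate (insert v s.sol) (s.rest.erase v) v' →
          f (insert v' (insert v s.sol)) - f (insert v s.sol) ≤ g := by
        intro v' hv'
        have hv'2 : v' ∉ insert v s.sol := hv'.2.1
        have h1 := marginal_anti hf (Finset.subset_insert v s.sol) hv'2
        have hi : M.Indep ((insert v' (insert v s.sol) : Finset E) : Set E) := hv'.2.2.1
        have hpos : f (insert v s.sol) < f (insert v' (insert v s.sol)) := hv'.2.2.2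
        have hc' : (oracle M f rk).Candidate s.sol (s.rest.erase v) v' := by
          refine ⟨hv'.1, fun h => hv'2 (Finset.mem_insert_of_mem h), hi.subset ?_, ?_⟩
          · exact_mod_cast Finset.insert_subset_insert _ (Finset.subset_insert _ _)
          · simp only [oracle]; linarith
        linarith [hmax' v' hc']
      have hdM2 : Disjoint (s.rest.erase v) (insert v s.sol) := by
        rw [Finset.disjoint_insert_right]; exact ⟨Finset.notMem_erase _ _, hdM'⟩
      by_cases hdep : M.Indep (insert v s.indep : Finset E)
      · have := ih J g (by linarith) hMv hI hdM2 hdI'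
          (hJM.trans (Finset.subset_insert _ _)) hJ hmax2
        simp only [hdep, not_true, and_false, if_false, Bool.true_eq_false, false_and, zero_add]
        linarith
      -- The gain `g` of the spanned element `v` is paid for by the unit of slack lost as `v` enters
      -- `J`.
      · have := ih (insert v J) g (by linarith) hMv hI hdM2 hdI'
          (Finset.insert_subset_insert _ hJM)
          (fun e he => by
            rcases Finset.mem_insert.1 he with rfl | he
            · exact ⟨hvI, hdep⟩
            · exact hJ e he) hmax2
        rw [Finset.card_insert_of_notMem (fun h => hvM (hJM h))] at this
        simp only [hdep, not_false_eq_true, and_true, if_true, Bool.true_eq_false, false_and,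
          if_false, zero_add]
        simp only [Nat.cast_add, Nat.cast_one] at this
        linarith
    | false =>
      by_cases hin : a v ∧ M.Indep (insert v s.indep : Finset E)
      · have hst : (s.step (oracle M f rk) l a v) =
            ⟨s.sol, insert v s.act, insert v s.indep, s.rest.erase v⟩ := by
          have : (oracle M f rk).ind (insert v s.indep) := hin.2
          simp [State.step, hl, hin.1, this]
        rw [hst] at ih ⊢
        have := ih J g (by linarith) hM hin.2 hdM' (by
            rw [Finset.disjoint_insert_right]; exact ⟨Finset.notMem_erase _ _, hdI'⟩) hJM
          (fun e he => by
            refine ⟨fun h => ?_, fun h => (hJ e he).2 (h.subset ?_)⟩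
            · rcases Finset.mem_insert.1 h with rfl | h
              · exact hvM (hJM he)
              · exact (hJ e he).1 h
            · exact_mod_cast Finset.insert_subset_insert _ (Finset.subset_insert _ _)) hmax'
        -- The extra unit of slack costs `g`, which is exactly the term that `v` adds to the
        -- right-hand side.
        rw [Finset.card_insert_of_notMem hvI] at this
        simp only [hin.1, hin.2, Bool.false_eq_true, false_and, if_false, and_self, if_true,
          zero_add]
        simp only [Nat.cast_add, Nat.cast_one] at this
        linarith
      · have hst1 : (s.step (oracle M f rk) l a v).indep = s.indep := by
          simp only [State.step, hl, true_and, ite_eq_right_iff]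
          exact fun h => absurd h hin
        have hst2 : (s.step (oracle M f rk) l a v).sol = s.sol := by simp [State.step, hl]
        have hst3 : (s.step (oracle M f rk) l a v).rest = s.rest.erase v := rfl
        rw [hst1, hst2, hst3] at ih
        have := ih J g (by linarith) hM hI hdM' hdI' hJM hJ hmax'
        simp only [Bool.false_eq_true, false_and, if_false, zero_add, true_and, hin]
        linarith

/-- The value that the elements of an independent set `T` add to the final solution is at most the
value of the elements of the solution and of the considered elements outside of it. -/
theorem sum_marginal_final_le (hrk : Function.Injective rk) (hf : IsNonnegSubmodular f)
    {T : Finset E} (hT : M.Indep (T : Set E)) (k : ℕ)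
    (s : State E) (hs : s.rest.card ≤ k) : ∀ G : ℝ, 0 ≤ G →
      M.Indep (s.sol : Set E) → Disjoint s.rest s.sol →
      (∀ v, (oracle M f rk).Candidate s.sol s.rest v → f (insert v s.sol) - f s.sol ≤ G) →
      open Classical in
      ∑ t ∈ (T ∩ s.rest).filter (fun t => M.Indep (insert t s.sol : Finset E)),
        (f (insert t (final (oracle M f rk) l a k s).sol) -
          f (final (oracle M f rk) l a k s).sol) ≤
      total (oracle M f rk) l a k s (fun u t => f (insert u t.sol) - f t.sol) +
        G * (s.sol.card -
          ((T ∩ s.rest).filter (fun t => ¬ M.Indep (insert t s.sol : Finset E))).card) := by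
  -- The same charging scheme, with slack `|sol|` minus the number of elements of `T` spanned by
  -- `sol`. Elements of `T` that are still feasible and unconsidered remain to be paid for.
  classical
  refine process_induction (O := oracle M f rk) hrk l a (P := fun k s => ∀ G : ℝ, 0 ≤ G →
      M.Indep (s.sol : Set E) → Disjoint s.rest s.sol →
      (∀ v, (oracle M f rk).Candidate s.sol s.rest v → f (insert v s.sol) - f s.sol ≤ G) →
      ∑ t ∈ (T ∩ s.rest).filter (fun t => M.Indep (insert t s.sol : Finset E)),
        (f (insert t (final (oracle M f rk) l a k s).sol) -
          f (final (oracle M f rk) l a k s).sol) ≤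
      total (oracle M f rk) l a k s (fun u t => f (insert u t.sol) - f t.sol) +
        G * (s.sol.card -
          ((T ∩ s.rest).filter (fun t => ¬ M.Indep (insert t s.sol : Finset E))).card))
    (fun k s hn G hG hM hd _ => ?_)
    (fun k s v hn hb ih G hG hM hd hmax => ?_) k s hs
  all_goals
    have hc : (((T ∩ s.rest).filter fun t => ¬ M.Indep (insert t s.sol : Finset E)).card : ℝ) ≤
        s.sol.card := by
      refine Nat.cast_le.2 (card_le_of_forall_dep hM (hT.subset ?_) fun e he => ?_)
      · exact_mod_cast (Finset.filter_subset _ _).trans Finset.inter_subset_left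
      · rw [Finset.mem_filter, Finset.mem_inter] at he
        exact ⟨Finset.disjoint_left.1 hd he.1.2, he.2⟩
  · rw [total_of_next_eq_none hn, final_of_next_eq_none hn, zero_add]
    refine le_trans (Finset.sum_nonpos fun t ht => ?_) (mul_nonneg hG (by linarith))
    rw [Finset.mem_filter, Finset.mem_inter] at ht
    by_contra hlt
    push Not at hlt
    exact Oracle.next_eq_none.1 hn t
      ⟨ht.1.2, Finset.disjoint_left.1 hd ht.1.2, ht.2, by simp only [oracle]; linarith⟩
  · have hvM : v ∉ s.sol := Finset.disjoint_left.1 hd hb.1.1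
    have hMv : M.Indep (insert v s.sol : Finset E) := hb.1.2.2.1
    have hlt : f s.sol < f (insert v s.sol) := hb.1.2.2.2
    have hgG := hmax v hb.1
    have hle : ∀ v' ∈ s.rest, M.Indep (insert v' s.sol : Finset E) →
        f (insert v' s.sol) - f s.sol ≤ f (insert v s.sol) - f s.sol := by
      intro v' hv' hi
      by_cases hpos : f s.sol < f (insert v' s.sol)
      · have := hb.val_le (v' := v') ⟨hv', Finset.disjoint_left.1 hd hv', hi, hpos⟩
        simp only [oracle] at this
        linarith
      · linarith
    set g := f (insert v s.sol) - f s.sol with hg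
    have hGd := mul_le_mul_of_nonneg_right hgG (sub_nonneg.2 hc)
    rw [total_succ hn hb.1.1, final_succ hn]
    have hrest : (s.step (oracle M f rk) l a v).rest = s.rest.erase v := rfl
    set F := (final (oracle M f rk) l a k (s.step (oracle M f rk) l a v)).sol with hF
    have hsub : (s.step (oracle M f rk) l a v).sol ⊆ F := sol_subset_final _ _
    have hgpos : 0 ≤ g := by linarith
    have hsolF : s.sol ⊆ F := by
      refine Finset.Subset.trans ?_ hsub
      simp only [State.step]
      split_ifs
      · exact Finset.subset_insert _ _
      · exact Finset.Subset.refl _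
    have hmarg : ∀ t ∈ s.rest, M.Indep (insert t s.sol : Finset E) →
        f (insert t F) - f F ≤ g := by
      intro t ht hi
      by_cases htF : t ∈ F
      · rw [Finset.insert_eq_of_mem htF]; linarith
      · exact (marginal_anti hf hsolF htF).trans (hle t ht hi)
    have hd' : Disjoint (s.rest.erase v) s.sol := hd.mono_left (Finset.erase_subset _ _)
    cases hl : l v with
    | true =>
      have hsol : (s.step (oracle M f rk) l a v).sol = insert v s.sol := by simp [State.step, hl]
      have hvF : v ∈ F := hsub (by rw [hsol]; exact Finset.mem_insert_self _ _)
      rw [hsol, hrest] at ih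
      have := ih g hgpos hMv (by
          rw [Finset.disjoint_insert_right]; exact ⟨Finset.notMem_erase _ _, hd'⟩) (by
        intro v' hv'
        have hv'2 : v' ∉ insert v s.sol := hv'.2.1
        have hi : M.Indep ((insert v' (insert v s.sol) : Finset E) : Set E) := hv'.2.2.1
        refine (marginal_anti hf (Finset.subset_insert v s.sol) hv'2).trans
          (hle v' (Finset.mem_of_mem_erase hv'.1) (hi.subset ?_))
        exact_mod_cast Finset.insert_subset_insert _ (Finset.subset_insert _ _))
      rw [Finset.card_insert_of_notMem hvM] at this
      set U := (T ∩ s.rest).filter fun t => M.Indep (insert t s.sol : Finset E)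
      set B := (T ∩ s.rest).filter fun t => ¬ M.Indep (insert t s.sol : Finset E)
      set U' := (T ∩ s.rest.erase v).filter fun t => M.Indep (insert t (insert v s.sol) : Finset E)
      set B' := (T ∩ s.rest.erase v).filter fun t =>
        ¬ M.Indep (insert t (insert v s.sol) : Finset E)
      have hmono : ∀ t, M.Indep (insert t (insert v s.sol) : Finset E) →
          M.Indep (insert t s.sol : Finset E) := fun t h => h.subset (by
        exact_mod_cast Finset.insert_subset_insert _ (Finset.subset_insert _ _))
      have hBB' : B ⊆ B' := by
        intro t ht
        simp only [B, B', Finset.mem_filter, Finset.mem_inter, Finset.mem_erase] at ht ⊢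
        exact ⟨⟨ht.1.1, by rintro rfl; exact ht.2 hMv, ht.1.2⟩, fun h => ht.2 (hmono t h)⟩
      -- The feasible elements of `T` either stay feasible or become spanned by adding `v`. Each
      -- newly spanned one has marginal at most `g` and uses a unit of slack.
      have hU : U.erase v = U' ∪ (B' \ B) := by
        ext t
        have := hmono t
        simp only [U, U', B, B', Finset.mem_filter, Finset.mem_inter, Finset.mem_erase,
          Finset.mem_union, Finset.mem_sdiff]
        tauto
      have hdisj : Disjoint U' (B' \ B) := by
        rw [Finset.disjoint_left]
        intro t ht ht'
        simp only [U', B', Finset.mem_filter, Finset.mem_sdiff] at ht ht'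
        exact ht'.1.2 ht.2
      have h1 : ∑ t ∈ U, (f (insert t F) - f F) = ∑ t ∈ U.erase v, (f (insert t F) - f F) := by
        rw [Finset.sum_erase]
        rw [Finset.insert_eq_of_mem hvF, sub_self]
      have h2 : ∑ t ∈ B' \ B, (f (insert t F) - f F) ≤ (B' \ B).card • g := by
        refine Finset.sum_le_card_nsmul _ _ _ fun t ht => ?_
        have htU : t ∈ U.erase v := by rw [hU]; exact Finset.mem_union_right _ ht
        have := Finset.mem_of_mem_erase htU
        simp only [U, Finset.mem_filter, Finset.mem_inter] at this
        exact hmarg t this.1.2 this.2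
      rw [nsmul_eq_mul, Finset.cast_card_sdiff hBB'] at h2
      rw [h1, hU, Finset.sum_union hdisj]
      simp only [Nat.cast_add, Nat.cast_one] at this
      linarith
    | false =>
      have hsol : (s.step (oracle M f rk) l a v).sol = s.sol := by simp [State.step, hl]
      rw [hsol, hrest] at ih
      have := ih g hgpos hM hd' (fun v' hv' => hle v' (Finset.mem_of_mem_erase hv'.1) hv'.2.2.1)
      have hU : ((T ∩ s.rest.erase v).filter fun t => M.Indep (insert t s.sol : Finset E)) =
          ((T ∩ s.rest).filter fun t => M.Indep (insert t s.sol : Finset E)).erase v := by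
        ext t
        simp only [Finset.mem_filter, Finset.mem_inter, Finset.mem_erase]
        tauto
      have hB : ((T ∩ s.rest.erase v).filter fun t => ¬ M.Indep (insert t s.sol : Finset E)) =
          (T ∩ s.rest).filter fun t => ¬ M.Indep (insert t s.sol : Finset E) := by
        ext t
        simp only [Finset.mem_filter, Finset.mem_inter, Finset.mem_erase]
        refine ⟨by tauto, fun h => ⟨⟨h.1.1, ?_, h.1.2⟩, h.2⟩⟩
        rintro rfl
        exact h.2 hMv
      rw [hU, hB] at this
      -- With the solution unchanged, only `v` itself may leave `T`'s feasible part, and its own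
      -- gain `g` pays for it.
      by_cases hv : v ∈ (T ∩ s.rest).filter fun t => M.Indep (insert t s.sol : Finset E)
      · rw [← Finset.add_sum_erase _ _ hv]
        linarith [hmarg v hb.1.1 hMv]
      · rw [Finset.erase_eq_of_notMem hv] at this
        linarith

/-- The value of a set of active elements is at least the sum of their marginals with respect to
the solution and the set of active elements at the moment when they are considered. -/
theorem sum_marginal_le_val (hrk : Function.Injective rk) (hf : IsNonnegSubmodular f)
    {Q : Finset E} (k : ℕ) (s : State E) (hs : s.rest.card ≤ k) :
      Disjoint s.rest (s.sol ∪ s.act) → ∀ P : Finset E, P ⊆ s.act →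
      (∀ u ∈ Q, u ∈ s.rest → (l u = false ∧ a u) ∧ visit (oracle M f rk) l a k s u ≠ none) →
      f P + total (oracle M f rk) l a k s (fun u t => if u ∈ Q then
        f (insert u (t.sol ∪ t.act)) - f (t.sol ∪ t.act) else 0) ≤ f (P ∪ (Q ∩ s.rest)) := by
  -- `P` stands for the part of `Q` considered so far. As `P ⊆ act`, marginals with respect to `P`
  -- dominate those with respect to `sol ∪ act`.
  refine process_induction (O := oracle M f rk) hrk l a (P := fun k s =>
      Disjoint s.rest (s.sol ∪ s.act) → ∀ P : Finset E, P ⊆ s.act →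
      (∀ u ∈ Q, u ∈ s.rest → (l u = false ∧ a u) ∧ visit (oracle M f rk) l a k s u ≠ none) →
      f P + total (oracle M f rk) l a k s (fun u t => if u ∈ Q then
        f (insert u (t.sol ∪ t.act)) - f (t.sol ∪ t.act) else 0) ≤ f (P ∪ (Q ∩ s.rest)))
    (fun k s hn hd P hP hQ => ?_)
    (fun k s v hn hb ih hd P hP hQ => ?_) k s hs
  · have : Q ∩ s.rest = ∅ := by
      rw [← Finset.disjoint_iff_inter_eq_empty, Finset.disjoint_left]
      exact fun u hu hu' => (hQ u hu hu').2 (visit_of_next_eq_none hn _ _)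
    rw [total_of_next_eq_none hn, this, Finset.union_empty, add_zero]
  · have hrest : (s.step (oracle M f rk) l a v).rest = s.rest.erase v := rfl
    have hact : s.act ⊆ (s.step (oracle M f rk) l a v).act := by
      simp only [State.step]
      split_ifs
      · exact Finset.subset_insert _ _
      · exact Finset.Subset.refl _
    have hd' : Disjoint (s.rest.erase v) ((s.step (oracle M f rk) l a v).sol ∪
        (s.step (oracle M f rk) l a v).act) := by
      have h : Disjoint (s.rest.erase v) (insert v (s.sol ∪ s.act)) := by
        rw [Finset.disjoint_insert_right]
        exact ⟨Finset.notMem_erase _ _, hd.mono_left (Finset.erase_subset _ _)⟩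
      refine h.mono_right ?_
      simp only [State.step]
      intro u
      split_ifs <;> simp only [Finset.mem_union, Finset.mem_insert] <;> tauto
    have hQ' : ∀ u ∈ Q, u ∈ s.rest.erase v → (l u = false ∧ a u) ∧
        visit (oracle M f rk) l a k (s.step (oracle M f rk) l a v) u ≠ none := by
      intro u hu hur
      have := hQ u hu (Finset.mem_of_mem_erase hur)
      rwa [visit_succ hn, if_neg (Finset.ne_of_mem_erase hur).symm] at this
    rw [total_succ hn hb.1.1]
    rw [hrest] at ih
    by_cases hv : v ∈ Q
    · have hva := (hQ v hv hb.1.1).1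
      have := ih hd' (insert v P) (by
        have : (s.step (oracle M f rk) l a v).act = insert v s.act := if_pos hva
        rw [this]
        exact Finset.insert_subset_insert _ hP) hQ'
      have hset : insert v P ∪ (Q ∩ s.rest.erase v) = P ∪ (Q ∩ s.rest) := by
        ext u
        have := hb.1.1
        by_cases huv : u = v
        · subst huv; simp [hv, this]
        · simp [huv]
      rw [hset] at this
      have hm := marginal_anti hf (hP.trans (Finset.subset_union_right : s.act ⊆ s.sol ∪ s.act))
        (Finset.disjoint_left.1 hd hb.1.1)
      rw [if_pos hv]
      linarith
    · have := ih hd' P (hP.trans hact) hQ'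
      have hset : Q ∩ s.rest.erase v = Q ∩ s.rest := by
        ext u
        simp only [Finset.mem_inter, Finset.mem_erase]
        refine ⟨by tauto, fun h => ⟨h.1, ?_, h.2⟩⟩
        rintro rfl
        exact hv h.1
      rw [hset] at this
      rw [if_neg hv]
      linarith

end Matroid

open scoped BigOperators

/-! ### Random sets, and resampling of one coordinate. -/

section Sampling

variable {E : Type v} [DecidableEq E]

/-- Elements are removed in order of increasing probability, and membership events need not be
independent. If `e` has the least probability `b`, restoring it gains at least `b (g S - g (S \ e))`
in expectation, and the second term cancels the `b g (S \ e)` of the induction hypothesis. -/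
theorem expect_val_ge_aux {X : Type*} [Fintype X] [Nonempty X] {g : Finset E → ℝ}
    (hg : IsNonnegSubmodular g) (R : X → Finset E) (p : ℝ) (n : ℕ) :
    ∀ (S : Finset E) (c : ℝ), S.card = n → 0 ≤ c → c ≤ p →
      (∀ e ∈ S, c ≤ 𝔼 x, (if e ∈ R x then 1 else 0 : ℝ)) →
      (∀ e ∈ S, 𝔼 x, (if e ∈ R x then 1 else 0 : ℝ) ≤ p) →
      (1 - p) * g ∅ + c * g S ≤ 𝔼 x, g (R x ∩ S) := by
  induction n with
  | zero =>
    intro S c hS _ hcp _ _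
    rw [Finset.card_eq_zero.1 hS]
    simp only [Finset.inter_empty, Finset.expect_const Finset.univ_nonempty]
    nlinarith [hg.nonneg ∅]
  | succ n ih =>
    intro S c hS hc hcp hcS hSp
    obtain ⟨e, he, hmin⟩ := Finset.exists_min_image S
      (fun e => 𝔼 x, (if e ∈ R x then 1 else 0 : ℝ)) (Finset.card_pos.1 (by omega))
    set b := 𝔼 x, (if e ∈ R x then 1 else 0 : ℝ) with hb
    have h1 := ih (S.erase e) b (by rw [Finset.card_erase_of_mem he]; omega)
      (hc.trans (hcS e he)) (hSp e he) (fun e' he' => hmin e' (Finset.mem_of_mem_erase he'))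
      (fun e' he' => hSp e' (Finset.mem_of_mem_erase he'))
    have h2 : ∀ x, g (R x ∩ S.erase e) + (if e ∈ R x then 1 else 0 : ℝ) * (g S - g (S.erase e)) ≤
        g (R x ∩ S) := by
      intro x
      split_ifs with hx
      · have := hg.diminishing (R x ∩ S.erase e) (S.erase e) Finset.inter_subset_right e
          (Finset.notMem_erase _ _)
        have hins : insert e (R x ∩ S.erase e) = R x ∩ S := by
          rw [← Finset.inter_insert_of_mem hx, Finset.insert_erase he]
        rw [Finset.insert_erase he, hins] at this
        linarith
      · have : R x ∩ S.erase e = R x ∩ S := by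
          rw [Finset.inter_erase, Finset.erase_eq_of_notMem]
          exact fun h => hx (Finset.mem_inter.1 h).1
        rw [this]; linarith
    have h3 := Finset.expect_le_expect (s := Finset.univ) fun x _ => h2 x
    rw [Finset.expect_add_distrib, ← Finset.expect_mul, ← hb] at h3
    have h4 : c * g S ≤ b * g S := mul_le_mul_of_nonneg_right (hcS e he) (hg.nonneg S)
    linarith

/-- Adding a random set that contains every element with probability at most `p` preserves, in
expectation, a fraction of `1 - p` of the value of a non-negative submodular function. -/
theorem expect_union_ge [Fintype E] {X : Type*} [Fintype X] [Nonempty X] {f : Finset E → ℝ}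
    (hf : IsNonnegSubmodular f) (T : Finset E) (R : X → Finset E) {p : ℝ} (hp : 0 ≤ p)
    (hR : ∀ e, 𝔼 x, (if e ∈ R x then 1 else 0 : ℝ) ≤ p) :
    (1 - p) * f T ≤ 𝔼 x, f (T ∪ R x) := by
  have hg : IsNonnegSubmodular fun S => f (T ∪ S) := by
    refine ⟨fun S => hf.nonneg _, fun A B hAB e he => ?_⟩
    simp only [Finset.union_insert]
    by_cases heT : e ∈ T
    · rw [Finset.insert_eq_of_mem (Finset.mem_union_left _ heT),
        Finset.insert_eq_of_mem (Finset.mem_union_left _ heT)]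
      linarith
    · exact hf.diminishing _ _ (Finset.union_subset_union_right hAB) e (by simp [heT, he])
  -- With `c = 0` only the term `(1 - p) g ∅ = (1 - p) f T` survives.
  have := expect_val_ge_aux hg R p _ Finset.univ 0 rfl le_rfl hp
    (fun e _ => Finset.expect_nonneg fun x _ => by split_ifs <;> norm_num) (fun e _ => hR e)
  simpa using this

/-- Flipping the coordinate `u` preserves the uniform measure. -/
theorem expect_flip [Fintype E] (u : E) (H : (E → Bool) → ℝ)
    (hH : ∀ l b, H (Function.update l u b) = H l) :
    𝔼 l, (if l u = false then H l else 0) = 𝔼 l, (if l u = true then H l else 0) := by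
  have hinv : Function.Involutive fun l : E → Bool => Function.update l u (!l u) := by
    intro l; simp
  refine Fintype.expect_equiv hinv.toPerm _ _ fun l => ?_
  simp [hH]

/-- Cyclic shifts of the coordinate `u` give all `m` values of `y u` the same contribution, and
these contributions add up to the whole. -/
theorem expect_shift [Fintype E] {m : ℕ} [NeZero m] (u : E) (H : (E → Fin m) → ℝ)
    (hH : ∀ y b, H (Function.update y u b) = H y) :
    𝔼 y, (if y u = 0 then H y else 0) = (1 / m) * 𝔼 y, H y := by
  have hm : (m : ℝ) ≠ 0 := Nat.cast_ne_zero.2 (NeZero.ne m)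
  have h1 : ∀ c : Fin m, 𝔼 y, (if y u = 0 then H y else 0) = 𝔼 y, (if y u = c then H y else 0) := by
    intro c
    refine Fintype.expect_equiv (Equiv.addRight (Pi.single u c)) _ _ fun y => ?_
    have : y + Pi.single u c = Function.update y u (y u + c) := by
      ext1 e
      by_cases h : e = u
      · subst h; simp
      · simp [h]
    simp [this, hH]
  have h2 : ∑ c : Fin m, 𝔼 y : E → Fin m, (if y u = c then H y else 0) = 𝔼 y, H y := by
    rw [← Finset.expect_sum_comm]
    simp
  rw [← h2, ← Finset.sum_congr rfl fun c _ => h1 c]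
  simp only [Finset.sum_const, Finset.card_univ, Fintype.card_fin, nsmul_eq_mul]
  field_simp

theorem expect_true [Fintype E] (u : E) : 𝔼 l : E → Bool, (if l u then 1 else 0 : ℝ) = 1 / 2 := by
  have h := expect_flip u (fun _ => 1) fun _ _ => rfl
  have h2 : 𝔼 l : E → Bool, ((if l u = false then 1 else 0 : ℝ) + if l u = true then 1 else 0) = 1 := by
    have : ∀ l : E → Bool, ((if l u = false then 1 else 0 : ℝ) + if l u = true then 1 else 0) = 1 := by
      intro l; cases l u <;> simp
    simp only [this]
    exact Finset.expect_const Finset.univ_nonempty _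
  rw [Finset.expect_add_distrib, h] at h2
  linarith

theorem expect_eq_zero [Fintype E] {m : ℕ} [NeZero m] (u : E) :
    𝔼 y : E → Fin m, (if y u = 0 then 1 else 0 : ℝ) = 1 / m := by
  rw [expect_shift u (fun _ => 1) fun _ _ => rfl, Finset.expect_const Finset.univ_nonempty, mul_one]

end Sampling

/-! ### Expected gain, independent weight and loss of the process. -/

section Expectation

variable {E : Type v} [Fintype E] [DecidableEq E] {m : ℕ} [NeZero m]

/-- The elements that become active when considered, unless they are sampled. -/
def active (y : E → Fin m) (u : E) : Bool := decide (y u = 0)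

/-- The initial state. -/
def start (E : Type v) [Fintype E] : State E := ⟨∅, ∅, ∅, Finset.univ⟩

/-- The sum of `F` over all elements considered in the whole process. -/
noncomputable def fullTotal (O : Oracle E) (l : E → Bool) (y : E → Fin m) (F : E → State E → ℝ) :
    ℝ :=
  total O l (active y) (Fintype.card E) (start E) F

/-- The final state of the whole process. -/
noncomputable def finish (O : Oracle E) (l : E → Bool) (y : E → Fin m) : State E :=
  final O l (active y) (Fintype.card E) (start E)

theorem expect_fullTotal_false (O : Oracle E) (y : E → Fin m) (F : E → State E → ℝ) :
    𝔼 l, fullTotal O l y (fun u t => if l u = false then F u t else 0) =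
      𝔼 l, fullTotal O l y (fun u t => if l u = true then F u t else 0) := by
  unfold fullTotal total
  rw [Finset.expect_sum_comm, Finset.expect_sum_comm]
  refine Finset.sum_congr rfl fun u _ => ?_
  have := expect_flip u
    (fun l => (visit O l (active y) (Fintype.card E) (start E) u).elim 0 (F u)) fun l b => by
      rw [visit_congr fun v hv => ⟨Function.update_of_ne hv _ _, rfl⟩]
  convert this using 2 with l _ l _
  · cases visit O l (active y) (Fintype.card E) (start E) u <;> simp
  · cases visit O l (active y) (Fintype.card E) (start E) u <;> simp

theorem expect_fullTotal_active (O : Oracle E) (l : E → Bool) (F : E → State E → ℝ) :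
    𝔼 y : E → Fin m, fullTotal O l y (fun u t => if active y u then F u t else 0) =
      (1 / m) * 𝔼 y : E → Fin m, fullTotal O l y F := by
  unfold fullTotal total
  rw [Finset.expect_sum_comm, Finset.expect_sum_comm, Finset.mul_sum]
  refine Finset.sum_congr rfl fun u _ => ?_
  have := expect_shift u
    (fun y : E → Fin m => (visit O l (active y) (Fintype.card E) (start E) u).elim 0 (F u))
    fun y b => by
      rw [visit_congr (l' := l) (a' := active y) fun v hv =>
        ⟨rfl, by simp [active, Function.update_of_ne hv]⟩]
  rw [← this]
  refine Finset.expect_congr rfl fun y _ => ?_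
  cases visit O l (active y) (Fintype.card E) (start E) u <;> simp [active]

/-- A considered element becomes active with `1 / m` times the probability of joining the
solution, independently of the state in which it is considered. -/
theorem expect_fullTotal_swap (O : Oracle E) (F : E → State E → ℝ) :
    𝔼 l, 𝔼 y : E → Fin m,
        fullTotal O l y (fun u t => if l u = false ∧ active y u then F u t else 0) =
      (1 / m) * 𝔼 l, 𝔼 y : E → Fin m, fullTotal O l y (fun u t => if l u then F u t else 0) := by
  have h1 : ∀ l, 𝔼 y : E → Fin m,
      fullTotal O l y (fun u t => if l u = false ∧ active y u then F u t else 0) =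
      (1 / m) * 𝔼 y : E → Fin m, fullTotal O l y (fun u t => if l u = false then F u t else 0) := by
    intro l
    rw [← expect_fullTotal_active]
    refine Finset.expect_congr rfl fun y _ => ?_
    congr 1
    ext u t
    by_cases h : l u = false <;> by_cases h' : active y u <;> simp [h, h']
  simp only [h1]
  rw [← Finset.mul_expect, Finset.expect_comm]
  simp only [expect_fullTotal_false]
  rw [Finset.expect_comm]

variable (M : Matroid E) (f : Finset E → ℝ) (rk : E → ℕ)

/-- The expected value gained by the greedy process. -/
noncomputable def greedyGain (m : ℕ) [NeZero m] : ℝ :=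
  𝔼 l, 𝔼 y : E → Fin m, fullTotal (oracle M f rk) l y
    (fun u t => if l u then f (insert u t.sol) - f t.sol else 0)

variable {M f rk}

theorem gain_eq (l : E → Bool) (y : E → Fin m) (u : E) :
    (oracle M f rk).gain l (Fintype.card E) Finset.univ u =
      (visit (oracle M f rk) l (active y) (Fintype.card E) (start E) u).elim 0
        fun t => f (insert u t.sol) - f t.sol := by
  have hv := visit_map_sol (O := oracle M f rk) (l := l) (a := active y) (Fintype.card E)
    (start E) u
  change _ = (oracle M f rk).stage l (Fintype.card E) ∅ Finset.univ u at hv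
  unfold Oracle.gain
  rw [← hv]
  cases visit (oracle M f rk) l (active y) (Fintype.card E) (start E) u <;> rfl

theorem greedyGain_nonneg (hrk : Function.Injective rk) : 0 ≤ greedyGain M f rk m := by
  refine Finset.expect_nonneg fun l _ => Finset.expect_nonneg fun y _ =>
    Finset.sum_nonneg fun u _ => ?_
  have h := Oracle.gain_nonneg (O := oracle M f rk) hrk l (Fintype.card E) Finset.univ u
  rw [gain_eq l y] at h
  cases hv : visit (oracle M f rk) l (active y) (Fintype.card E) (start E) u with
  | none => simp
  | some t =>
    rw [hv] at h
    simp only [Option.elim_some] at h ⊢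
    split_ifs
    · exact h
    · exact le_rfl

/-- The value of an independent set is bounded in terms of the greedy value. -/
theorem val_le_greedyGain (hrk : Function.Injective rk) (hf : IsNonnegSubmodular f)
    {T : Finset E} (hT : M.Indep (T : Set E)) : f T ≤ 2 * f ∅ + 6 * greedyGain M f rk m := by
  classical
  have h1 : ∀ y : E → Fin m, (1 - 1 / 2) * f T ≤ 𝔼 l, f (T ∪ (finish (oracle M f rk) l y).sol) := by
    intro y
    refine expect_union_ge hf T _ (by norm_num) fun e => ?_
    rw [← expect_true e]
    refine Finset.expect_le_expect fun l _ => ?_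
    by_cases he : e ∈ (finish (oracle M f rk) l y).sol
    · have := (mem_final_sol _ _ he).resolve_left (by simp [start])
      simp [he, this]
    · rw [if_neg he]; split_ifs <;> norm_num
  -- The solution contributes its value, and the marginals of `T` are at most the gains of all
  -- considered elements. Sampled gains thus count twice and unsampled gains once, which gives `3W`
  -- in expectation.
  have h2 : ∀ l (y : E → Fin m), f (T ∪ (finish (oracle M f rk) l y).sol) ≤ f ∅ +
      2 * fullTotal (oracle M f rk) l y (fun u t => if l u then f (insert u t.sol) - f t.sol else 0) +
      fullTotal (oracle M f rk) l y
        (fun u t => if l u = false then f (insert u t.sol) - f t.sol else 0) := by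
    intro l y
    have ha := val_final_sol (O := oracle M f rk) (l := l) (a := active y) hrk (Fintype.card E)
      (start E) le_rfl
    have hb := sum_marginal_final_le (l := l) (a := active y) hrk hf hT (Fintype.card E) (start E)
      le_rfl (∑ v, |f {v} - f ∅|) (Finset.sum_nonneg fun v _ => abs_nonneg _)
      (by simp [start]) (by simp [start]) (fun v _ => by
        refine (le_abs_self _).trans ?_
        exact Finset.single_le_sum (f := fun v => |f {v} - f ∅|) (fun v _ => abs_nonneg _)
          (Finset.mem_univ v))
    have hall : ∀ t ∈ T, M.Indep ((insert t (start E).sol : Finset E) : Set E) := fun t ht =>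
      hT.subset (by simpa [start] using ht)
    have hT1 : (T ∩ (start E).rest).filter
        (fun t => M.Indep ((insert t (start E).sol : Finset E) : Set E)) = T := by
      rw [Finset.filter_true_of_mem] <;> simp only [start, Finset.inter_univ]
      exact hall
    rw [hT1] at hb
    -- The initial solution is empty, so the slack term is nonpositive and the crude bound `G`
    -- disappears.
    have hc : (((start E).sol.card : ℝ) - (((T ∩ (start E).rest).filter
        (fun t => ¬ M.Indep ((insert t (start E).sol : Finset E) : Set E))).card : ℝ)) ≤ 0 := by
      simp [start]
    have hc' := mul_nonpos_of_nonneg_of_nonpos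
      (Finset.sum_nonneg fun v _ => abs_nonneg _ : 0 ≤ ∑ v, |f {v} - f ∅|) hc
    have hd := union_le_add_sum hf (finish (oracle M f rk) l y).sol T
    have he := total_add (O := oracle M f rk) (l := l) (a := active y) (Fintype.card E) (start E)
      (fun u t => if l u then f (insert u t.sol) - f t.sol else 0)
      (fun u t => if l u = false then f (insert u t.sol) - f t.sol else 0)
    have hf' : (fun (u : E) (t : State E) => (if l u then f (insert u t.sol) - f t.sol else 0) +
        (if l u = false then f (insert u t.sol) - f t.sol else 0)) =
        fun u t => f (insert u t.sol) - f t.sol := by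
      ext u t; cases l u <;> simp
    rw [hf'] at he
    rw [he] at hb
    simp only [finish, fullTotal, oracle] at *
    have : (start E).sol = ∅ := rfl
    rw [this] at ha
    linarith
  have h3 := Finset.expect_le_expect (s := Finset.univ) fun (y : E → Fin m) _ =>
    (h1 y).trans (Finset.expect_le_expect (s := Finset.univ) fun l _ => h2 l y)
  simp only [Finset.expect_add_distrib, ← Finset.mul_expect, expect_fullTotal_false,
    Finset.expect_const Finset.univ_nonempty] at h3
  rw [Finset.expect_comm] at h3
  unfold greedyGain
  linarith

/-- The active elements contain an independent set of large weight. -/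
theorem greedyGain_le_indep (hrk : Function.Injective rk) (hf : IsNonnegSubmodular f) :
    greedyGain M f rk m ≤ (m + 1) * 𝔼 l, 𝔼 y : E → Fin m,
      ∑ u ∈ (finish (oracle M f rk) l y).indep,
        (if l u = false ∧ active y u then (oracle M f rk).gain l (Fintype.card E) Finset.univ u
          else 0) := by
  classical
  have hm : (m : ℝ) ≠ 0 := Nat.cast_ne_zero.2 (NeZero.ne m)
  set F : E → State E → ℝ := fun u t =>
    if M.Indep (insert u t.indep : Finset E) then f (insert u t.sol) - f t.sol else 0 with hF
  -- Solution elements not spanned by `indep` are counted by `F`; spanned ones are charged to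
  -- `indep`. By the swap identity the first sum is, in expectation, `m` times the second, whence
  -- the factor `m + 1`.
  have h1 : ∀ l (y : E → Fin m), fullTotal (oracle M f rk) l y
      (fun u t => if l u then f (insert u t.sol) - f t.sol else 0) ≤
      fullTotal (oracle M f rk) l y (fun u t => if l u then F u t else 0) +
      fullTotal (oracle M f rk) l y (fun u t => if l u = false ∧ active y u then F u t else 0) := by
    intro l y
    have hb := total_dep_le (M := M) (l := l) (a := active y) hrk hf (Fintype.card E) (start E)
      le_rfl ∅ (∑ v, |f {v} - f ∅|) (Finset.sum_nonneg fun v _ => abs_nonneg _)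
      (by simp [start]) (by simp [start]) (by simp [start]) (by simp [start]) (by simp)
      (by simp) (fun v _ => by
        refine (le_abs_self _).trans ?_
        exact Finset.single_le_sum (f := fun v => |f {v} - f ∅|) (fun v _ => abs_nonneg _)
          (Finset.mem_univ v))
    have he := total_add (O := oracle M f rk) (l := l) (a := active y) (Fintype.card E) (start E)
      (fun u t => if l u then F u t else 0)
      (fun u t => if l u ∧ ¬ M.Indep (insert u t.indep : Finset E)
        then f (insert u t.sol) - f t.sol else 0)
    have hf' : (fun (u : E) (t : State E) => (if l u then F u t else 0) +
        (if l u ∧ ¬ M.Indep (insert u t.indep : Finset E)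
          then f (insert u t.sol) - f t.sol else 0)) =
        fun u t => if l u then f (insert u t.sol) - f t.sol else 0 := by
      ext u t
      by_cases h : l u <;> by_cases h' : M.Indep (insert u t.indep : Finset E) <;>
        simp only [h, h', hF] <;> simp
    have hg' : (fun (u : E) (t : State E) => if (l u = false ∧ active y u) ∧
        M.Indep (insert u t.indep : Finset E) then f (insert u t.sol) - f t.sol else 0) =
        fun u t => if l u = false ∧ active y u then F u t else 0 := by
      ext u t
      by_cases h : l u = false ∧ active y u <;>
        by_cases h' : M.Indep (insert u t.indep : Finset E) <;> simp only [h, h', hF] <;> simp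
    rw [hf'] at he
    rw [hg'] at hb
    have hc : ∑ v, |f {v} - f ∅| * (((start E).indep.card : ℝ) - ((∅ : Finset E).card : ℝ)) = 0 := by
      simp [start]
    rw [← Finset.sum_mul] at hc
    unfold fullTotal
    linarith
  have h2 : ∀ l (y : E → Fin m), ∑ u ∈ (finish (oracle M f rk) l y).indep,
        (if l u = false ∧ active y u then (oracle M f rk).gain l (Fintype.card E) Finset.univ u
          else 0) =
      fullTotal (oracle M f rk) l y (fun u t => if l u = false ∧ active y u then F u t else 0) := by
    intro l y
    unfold finish
    rw [sum_final_indep (O := oracle M f rk) hrk _ (Fintype.card E) (start E) le_rfl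
      (by simp [start])]
    have : (start E).indep = ∅ := rfl
    rw [this, Finset.sum_empty, zero_add]
    unfold fullTotal total
    refine Finset.sum_congr rfl fun u _ => ?_
    beta_reduce
    rw [gain_eq l y]
    cases visit (oracle M f rk) l (active y) (Fintype.card E) (start E) u with
    | none => simp
    | some t =>
      have hind : (oracle M f rk).ind (insert u t.indep) ↔
        M.Indep (insert u t.indep : Finset E) := Iff.rfl
      by_cases h : l u = false ∧ active y u <;>
        by_cases h' : M.Indep (insert u t.indep : Finset E) <;>
        simp only [h, h', hF, hind, Option.elim_some] <;> simp
  simp only [h2]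
  have h3 := Finset.expect_le_expect (s := Finset.univ) fun l _ =>
    Finset.expect_le_expect (s := Finset.univ) fun (y : E → Fin m) _ => h1 l y
  simp only [Finset.expect_add_distrib] at h3
  have h4 := expect_fullTotal_swap (m := m) (oracle M f rk) F
  unfold greedyGain
  rw [h4] at h3 ⊢
  refine h3.trans (le_of_eq ?_)
  field_simp

/-- The loss of a considered element: the amount by which its marginal decreases when the active
elements are added to the solution. -/
def loss (f : Finset E → ℝ) (u : E) (t : State E) : ℝ :=
  (f (insert u t.sol) - f t.sol) - (f (insert u (t.sol ∪ t.act)) - f (t.sol ∪ t.act))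

/-- With `Y` the expected marginals of sampled elements with respect to `sol ∪ act`, the swap
identity makes the loss `(W - Y)/m` and the expected value of the final union `f ∅ + (1 + 1/m) Y`.
The latter is at least `(1 - 1/m)(f ∅ + W)`, since active elements are rare; hence `(m+1)(W - Y) ≤
2W + f ∅`. -/
theorem expect_loss_le (hrk : Function.Injective rk) (hf : IsNonnegSubmodular f) :
    m * (m + 1) * 𝔼 l, 𝔼 y : E → Fin m, fullTotal (oracle M f rk) l y
      (fun u t => if l u = false ∧ active y u then loss f u t else 0) ≤
    2 * greedyGain M f rk m + f ∅ := by
  have hm : (0 : ℝ) < m := Nat.cast_pos.2 (NeZero.pos m)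
  set F : E → State E → ℝ := fun u t => f (insert u (t.sol ∪ t.act)) - f (t.sol ∪ t.act) with hF
  set Y := 𝔼 l, 𝔼 y : E → Fin m, fullTotal (oracle M f rk) l y
    (fun u t => if l u then F u t else 0) with hY
  rw [expect_fullTotal_swap]
  have h1 : 𝔼 l, 𝔼 y : E → Fin m, fullTotal (oracle M f rk) l y
      (fun u t => if l u then loss f u t else 0) = greedyGain M f rk m - Y := by
    unfold greedyGain
    rw [hY]
    simp only [← Finset.expect_sub_distrib]
    refine Finset.expect_congr rfl fun l _ => Finset.expect_congr rfl fun y _ => ?_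
    unfold fullTotal
    rw [← total_sub]
    congr 1
    ext u t
    split_ifs
    · rfl
    · simp
  have h2 : ∀ l (y : E → Fin m), f ((finish (oracle M f rk) l y).sol ∪
      (finish (oracle M f rk) l y).act) = f ∅ +
      (fullTotal (oracle M f rk) l y (fun u t => if l u then F u t else 0) +
      fullTotal (oracle M f rk) l y (fun u t => if l u = false ∧ active y u then F u t else 0)) := by
    intro l y
    have := val_final_union (O := oracle M f rk) (l := l) (a := active y) hrk (Fintype.card E)
      (start E) le_rfl
    have h0 : (start E).sol ∪ (start E).act = ∅ := by simp [start]
    rw [h0] at this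
    unfold fullTotal
    rw [← total_add]
    refine Eq.trans this ?_
    congr 2
    ext u t
    cases l u <;> cases active y u <;> simp [hF, oracle]
  have h3 : ∀ l, (1 - 1 / (m : ℝ)) * 𝔼 y : E → Fin m, f (finish (oracle M f rk) l y).sol ≤
      𝔼 y : E → Fin m, f ((finish (oracle M f rk) l y).sol ∪ (finish (oracle M f rk) l y).act) := by
    intro l
    have hs : ∀ y : E → Fin m, (finish (oracle M f rk) l y).sol =
        (finish (oracle M f rk) l (0 : E → Fin m)).sol := fun y => final_sol_congr _ _ _ rfl rfl
    simp only [hs]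
    rw [Finset.expect_const Finset.univ_nonempty]
    refine expect_union_ge hf _ _ (by positivity) fun e => ?_
    rw [← expect_eq_zero e]
    refine Finset.expect_le_expect fun y _ => ?_
    by_cases he : e ∈ (finish (oracle M f rk) l y).act
    · have := (mem_final_act _ _ he).resolve_left (by simp [start])
      have h0 : y e = 0 := by simpa [active] using this
      simp [he, h0]
    · rw [if_neg he]; split_ifs <;> norm_num
  have h4 : ∀ l (y : E → Fin m), f (finish (oracle M f rk) l y).sol = f ∅ +
      fullTotal (oracle M f rk) l y (fun u t => if l u then f (insert u t.sol) - f t.sol else 0) :=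
    fun l y => val_final_sol (O := oracle M f rk) (l := l) (a := active y) hrk (Fintype.card E)
      (start E) le_rfl
  have h5 := Finset.expect_le_expect (s := Finset.univ) fun l _ => h3 l
  simp only [h2, h4, Finset.expect_add_distrib, ← Finset.mul_expect,
    Finset.expect_const Finset.univ_nonempty] at h5
  rw [expect_fullTotal_swap, ← hY] at h5
  change (1 - 1 / (m : ℝ)) * (f ∅ + greedyGain M f rk m) ≤ _ at h5
  rw [h1]
  have h6 := mul_le_mul_of_nonneg_left h5 hm.le
  field_simp at h6
  have h7 : (m : ℝ) * (m + 1) * (1 / m * (greedyGain M f rk m - Y)) =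
      (m + 1) * (greedyGain M f rk m - Y) := by field_simp
  rw [h7]
  linarith

end Expectation

open MeasureTheory

/-! ### The derived linear instance. -/

section Analysis

variable {E : Type v} [DecidableEq E] {M : Matroid E} {f : Finset E → ℝ} {rk : E → ℕ}

theorem notMem_of_visit_eq_some (hrk : Function.Injective rk) {l a : E → Bool} {u : E}
    {t : State E} (k : ℕ) (s : State E) (hs : s.rest.card ≤ k) :
    Disjoint s.rest (s.sol ∪ s.act) → visit (oracle M f rk) l a k s u = some t →
      u ∉ t.sol ∪ t.act := by
  refine process_induction (O := oracle M f rk) hrk l a (P := fun k s =>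
    Disjoint s.rest (s.sol ∪ s.act) → visit (oracle M f rk) l a k s u = some t →
      u ∉ t.sol ∪ t.act) (fun k s hn _ h => ?_) (fun k s v hn hb ih hd h => ?_) k s hs
  · rw [visit_of_next_eq_none hn] at h
    cases h
  · rw [visit_succ hn] at h
    split_ifs at h with hv
    · cases h
      subst hv
      exact Finset.disjoint_left.1 hd hb.1.1
    · refine ih ?_ h
      have h : Disjoint (s.rest.erase v) (insert v (s.sol ∪ s.act)) := by
        rw [Finset.disjoint_insert_right]
        exact ⟨Finset.notMem_erase _ _, hd.mono_left (Finset.erase_subset _ _)⟩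
      refine h.mono_right ?_
      simp only [State.step]
      intro u
      split_ifs <;> simp only [Finset.mem_union, Finset.mem_insert] <;> tauto

variable [Fintype E] {m : ℕ} [NeZero m]

/-- The weight of an element in the derived linear instance: its marginal value when considered,
if it is active, and zero otherwise. -/
noncomputable def weight (O : Oracle E) (l : E → Bool) (y : E → Fin m) (u : E) : ℝ :=
  if l u = false ∧ active y u then O.gain l (Fintype.card E) Finset.univ u else 0

theorem weight_nonneg {O : Oracle E} (hO : Function.Injective O.rank) (l : E → Bool)
    (y : E → Fin m) (u : E) : 0 ≤ weight O l y u := by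
  unfold weight
  split_ifs
  · exact Oracle.gain_nonneg hO _ _ _ _
  · exact le_rfl

/-- The elements of `Z` of positive weight. -/
noncomputable def positivePart (O : Oracle E) (l : E → Bool) (y : E → Fin m) (Z : Finset E) :
    Finset E :=
  open Classical in Z.filter fun u => 0 < weight O l y u

variable (M f rk) in
/-- The loss of `u` in the state in which it is considered. -/
noncomputable def lossAt (l : E → Bool) (y : E → Fin m) (u : E) : ℝ :=
  (visit (oracle M f rk) l (active y) (Fintype.card E) (start E) u).elim 0 (loss f u)

theorem lossAt_nonneg (hrk : Function.Injective rk) (hf : IsNonnegSubmodular f) (l : E → Bool)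
    (y : E → Fin m) (u : E) : 0 ≤ lossAt M f rk l y u := by
  unfold lossAt
  cases h : visit (oracle M f rk) l (active y) (Fintype.card E) (start E) u with
  | none => exact le_rfl
  | some t =>
    have := marginal_anti hf (Finset.subset_union_left : t.sol ⊆ t.sol ∪ t.act)
      (notMem_of_visit_eq_some hrk (Fintype.card E) (start E) le_rfl (by simp [start]) h)
    simp only [Option.elim_some, loss]
    linarith

theorem weight_pos {O : Oracle E} {l : E → Bool} {y : E → Fin m} {u : E}
    (h : 0 < weight O l y u) : l u = false ∧ active y u := by
  unfold weight at h
  split_ifs at h with h'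
  · exact h'
  · exact absurd h (lt_irrefl _)

/-- Weight minus loss is the marginal with respect to `sol ∪ act`. The restriction to positive
weight matters because `f` need not be monotone: zero-weight elements chosen by the linear algorithm
could destroy value. -/
theorem val_positivePart_ge (hrk : Function.Injective rk) (hf : IsNonnegSubmodular f)
    (l : E → Bool) (y : E → Fin m) (Z : Finset E) :
    f ∅ + ∑ u, (if u ∈ Z then
      (open Classical in if 0 < weight (oracle M f rk) l y u then
        weight (oracle M f rk) l y u - lossAt M f rk l y u else 0) else 0) ≤
      f (positivePart (oracle M f rk) l y Z) := by
  classical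
  set Q := positivePart (oracle M f rk) l y Z with hQ
  have hmem : ∀ u, u ∈ Q ↔ u ∈ Z ∧ 0 < weight (oracle M f rk) l y u := by
    intro u; simp [hQ, positivePart]
  have hvis : ∀ u ∈ Q, visit (oracle M f rk) l (active y) (Fintype.card E) (start E) u ≠ none := by
    intro u hu hn
    have hp := ((hmem u).1 hu).2
    unfold weight at hp
    rw [if_pos (weight_pos ((hmem u).1 hu).2), gain_eq l y, hn] at hp
    exact lt_irrefl _ hp
  have h := sum_marginal_le_val (M := M) (l := l) (a := active y) hrk hf (Q := Q)
    (Fintype.card E) (start E) le_rfl (by simp [start]) ∅ (Finset.empty_subset _)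
    (fun u hu _ => ⟨weight_pos ((hmem u).1 hu).2, hvis u hu⟩)
  have hr : ∅ ∪ Q ∩ (start E).rest = Q := by simp [start]
  rw [hr] at h
  refine le_trans (le_of_eq ?_) h
  congr 1
  unfold total
  refine Finset.sum_congr rfl fun u _ => ?_
  by_cases hu : u ∈ Q
  · have hu' := (hmem u).1 hu
    rw [if_pos hu'.1, if_pos hu'.2]
    obtain ⟨t, ht⟩ := Option.ne_none_iff_exists'.1 (hvis u hu)
    unfold weight lossAt
    rw [if_pos (weight_pos hu'.2), gain_eq l y, ht]
    simp [hu, loss]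
  · have : (if u ∈ Z then (if 0 < weight (oracle M f rk) l y u then
        weight (oracle M f rk) l y u - lossAt M f rk l y u else 0) else 0 : ℝ) = 0 := by
      rw [hmem] at hu
      split_ifs <;> tauto
    rw [this]
    cases visit (oracle M f rk) l (active y) (Fintype.card E) (start E) u <;> simp [hu]

end Analysis

/-! ### Expectations of outputs. -/

section Measurability

variable {E : Type v} [Fintype E]

theorem measurable_output (A : OnlineAlgorithm.{u}) (M : Matroid E) (f : Finset E → ℝ)
    (σ : ArrivalOrder E) (g : Finset E → ℝ) : Measurable fun ω => g (A.output M f σ ω) := by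
  have h1 : Measurable fun ω : (A (Fintype.card E)).Ω => fun i =>
      (A (Fintype.card E)).accept i ω (fun S => M.Indep (arrivedSet σ i S : Set E))
        (fun S => f (arrivedSet σ i S)) :=
    measurable_pi_lambda _ fun i => (A (Fintype.card E)).measurable_accept _ _ _
  have h2 : Measurable fun b : Fin (Fintype.card E) → Bool =>
      g ((Finset.univ.filter fun i => b i = true).map σ.toEmbedding) := measurable_of_finite _
  exact h2.comp h1

theorem integrable_output (A : OnlineAlgorithm.{u}) (M : Matroid E) (f : Finset E → ℝ)
    (σ : ArrivalOrder E) (g : Finset E → ℝ) :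
    Integrable (fun ω => g (A.output M f σ ω)) (A (Fintype.card E)).law := by
  refine Integrable.of_bound (measurable_output A M f σ g).aestronglyMeasurable (∑ S, |g S|)
    (Filter.Eventually.of_forall fun ω => ?_)
  rw [Real.norm_eq_abs]
  exact Finset.single_le_sum (f := fun S => |g S|) (fun S _ => abs_nonneg _) (Finset.mem_univ _)

variable [DecidableEq E]

theorem selectionProb_eq (A : OnlineAlgorithm.{u}) (M : Matroid E) (f : Finset E → ℝ) (e : E) :
    A.selectionProb M f e = 𝔼 σ : ArrivalOrder E,
      ∫ ω, (if e ∈ A.output M f σ ω then 1 else 0 : ℝ) ∂(A (Fintype.card E)).law := by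
  unfold OnlineAlgorithm.selectionProb
  rw [Fintype.expect_eq_sum_div_card]
  congr 1
  refine Finset.sum_congr rfl fun σ _ => ?_
  have hms : MeasurableSet {ω | e ∈ A.output M f σ ω} := by
    have := (measurable_output A M f σ fun S => if e ∈ S then 1 else 0)
      (measurableSet_singleton (1 : ℝ))
    convert this using 1
    ext ω
    simp
  rw [← integral_indicator_one hms]
  refine integral_congr_ae (Filter.Eventually.of_forall fun ω => ?_)
  simp [Set.indicator_apply]

theorem expectedValue_eq (A : OnlineAlgorithm.{u}) (M : Matroid E) (f : Finset E → ℝ) :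
    A.expectedValue M f = 𝔼 σ : ArrivalOrder E,
      ∫ ω, f (A.output M f σ ω) ∂(A (Fintype.card E)).law := by
  unfold OnlineAlgorithm.expectedValue
  rw [Fintype.expect_eq_sum_div_card]

/-- The expected value of an affine function of the output. -/
theorem expect_integral_sum (A : OnlineAlgorithm.{u}) (M : Matroid E) (f : Finset E → ℝ) (b : ℝ)
    (c : E → ℝ) : 𝔼 σ : ArrivalOrder E, ∫ ω, (b + ∑ u, if u ∈ A.output M f σ ω then c u else 0)
      ∂(A (Fintype.card E)).law = b + ∑ u, c u * A.selectionProb M f u := by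
  have h1 : ∀ σ : ArrivalOrder E, ∫ ω, (b + ∑ u, if u ∈ A.output M f σ ω then c u else 0)
      ∂(A (Fintype.card E)).law = b + ∑ u, c u * ∫ ω, (if u ∈ A.output M f σ ω then 1 else 0 : ℝ)
        ∂(A (Fintype.card E)).law := by
    intro σ
    rw [integral_add (integrable_const _)
      (integrable_output A M f σ fun S => ∑ u, if u ∈ S then c u else 0), integral_const]
    rw [integral_finsetSum _ fun u _ => integrable_output A M f σ fun S => if u ∈ S then c u else 0]
    simp only [probReal_univ, one_smul]
    congr 1
    refine Finset.sum_congr rfl fun u _ => ?_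
    rw [← integral_const_mul]
    simp
  simp only [h1]
  rw [Finset.expect_add_distrib, Finset.expect_const ⟨(Fintype.equivFin E).symm, Finset.mem_univ _⟩,
    Finset.expect_sum_comm]
  simp only [selectionProb_eq, Finset.mul_expect]

theorem expectedValue_linearObjective (A : OnlineAlgorithm.{u}) (M : Matroid E) (w : E → ℝ) :
    A.expectedValue M (linearObjective w) =
      ∑ u, w u * A.selectionProb M (linearObjective w) u := by
  rw [expectedValue_eq, ← zero_add (∑ u, _), ← expect_integral_sum]
  simp [linearObjective]

end Measurability

/-! ### The expected value for a fixed ranking. -/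

section Value

variable {E : Type v} [Fintype E] [DecidableEq E] {M : Matroid E} {f : Finset E → ℝ} {rk : E → ℕ}
  {m : ℕ} [NeZero m]

/-- For fixed coins and marks the weights are fixed, so both hypotheses on `Lin` apply:
competitiveness against the independent set built by the process, and the selection bound against
the losses. -/
theorem expect_positivePart_ge (hrk : Function.Injective rk) (hf : IsNonnegSubmodular f)
    {Lin : OnlineAlgorithm.{u}} {α q : ℝ} (hα : 0 < α) (hLα : Lin.MSPCompetitive M α)
    (hLq : Lin.MSPSelectionBound M q) (l : E → Bool) (y : E → Fin m) :
    f ∅ + (1 / α) * ∑ u ∈ (finish (oracle M f rk) l y).indep, weight (oracle M f rk) l y u -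
      q * fullTotal (oracle M f rk) l y
        (fun u t => if l u = false ∧ active y u then loss f u t else 0) ≤
      𝔼 τ : ArrivalOrder E, ∫ ω, f (positivePart (oracle M f rk) l y
        (Lin.output M (linearObjective (weight (oracle M f rk) l y)) τ ω))
        ∂(Lin (Fintype.card E)).law := by
  classical
  set w := weight (oracle M f rk) l y with hw
  have hw0 : ∀ e, 0 ≤ w e := weight_nonneg hrk l y
  have h1 : f ∅ + ∑ u, (if 0 < w u then w u - lossAt M f rk l y u else 0) *
      Lin.selectionProb M (linearObjective w) u ≤
      𝔼 τ : ArrivalOrder E, ∫ ω, f (positivePart (oracle M f rk) l y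
        (Lin.output M (linearObjective w) τ ω)) ∂(Lin (Fintype.card E)).law := by
    rw [← expect_integral_sum]
    refine Finset.expect_le_expect fun τ _ => ?_
    refine integral_mono (integrable_output Lin M _ τ fun S =>
        f ∅ + ∑ u, if u ∈ S then (if 0 < w u then w u - lossAt M f rk l y u else 0) else 0)
      (integrable_output Lin M _ τ fun S => f (positivePart (oracle M f rk) l y S)) fun ω => ?_
    exact val_positivePart_ge hrk hf l y _
  have h2 : fullTotal (oracle M f rk) l y
      (fun u t => if l u = false ∧ active y u then loss f u t else 0) =
      ∑ u, if l u = false ∧ active y u then lossAt M f rk l y u else 0 := by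
    unfold fullTotal total lossAt
    refine Finset.sum_congr rfl fun u _ => ?_
    cases visit (oracle M f rk) l (active y) (Fintype.card E) (start E) u <;> simp
  have h3 : ∑ u ∈ (finish (oracle M f rk) l y).indep, w u ≤
      α * ∑ u, w u * Lin.selectionProb M (linearObjective w) u := by
    rw [← expectedValue_linearObjective]
    exact hLα w hw0 _ (ind_final_indep (O := oracle M f rk) _ _ (by simp [start, oracle]))
  have h4 : (1 / α) * ∑ u ∈ (finish (oracle M f rk) l y).indep, w u ≤
      ∑ u, w u * Lin.selectionProb M (linearObjective w) u := by
    rw [one_div, inv_mul_le_iff₀ hα]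
    exact h3
  refine le_trans ?_ h1
  rw [h2]
  -- Losses are non-negative, so bounding each selection probability by `q` is legitimate.
  have h5 : ∑ u, w u * Lin.selectionProb M (linearObjective w) u -
      ∑ u, q * (if l u = false ∧ active y u then lossAt M f rk l y u else 0) ≤
      ∑ u, (if 0 < w u then w u - lossAt M f rk l y u else 0) *
      Lin.selectionProb M (linearObjective w) u := by
    rw [← Finset.sum_sub_distrib]
    refine Finset.sum_le_sum fun u _ => ?_
    have hl := lossAt_nonneg (M := M) hrk hf l y u
    have hs := hLq w hw0 u
    have hs0 : 0 ≤ Lin.selectionProb M (linearObjective w) u := by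
      rw [selectionProb_eq]
      refine Finset.expect_nonneg fun τ _ => integral_nonneg fun ω => ?_
      dsimp only
      split_ifs <;> norm_num
    by_cases hp : 0 < w u
    · rw [if_pos hp, if_pos (weight_pos hp)]
      nlinarith
    · have : w u = 0 := le_antisymm (not_lt.1 hp) (hw0 u)
      rw [if_neg hp, this]
      have hq : 0 ≤ q := hs0.trans hs
      split_ifs <;> nlinarith
  rw [← Finset.mul_sum] at h5
  linarith

theorem expect_positivePart_ge' (hrk : Function.Injective rk) (hf : IsNonnegSubmodular f)
    {Lin : OnlineAlgorithm.{u}} {α q : ℝ} (hα : 0 < α) (hq : 0 ≤ q)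
    (hLα : Lin.MSPCompetitive M α) (hLq : Lin.MSPSelectionBound M q) :
    f ∅ + greedyGain M f rk m / ((m + 1) * α) -
      q * (2 * greedyGain M f rk m + f ∅) / (m * (m + 1)) ≤
      𝔼 l, 𝔼 y : E → Fin m, 𝔼 τ : ArrivalOrder E, ∫ ω, f (positivePart (oracle M f rk) l y
        (Lin.output M (linearObjective (weight (oracle M f rk) l y)) τ ω))
        ∂(Lin (Fintype.card E)).law := by
  have hm : (0 : ℝ) < m := Nat.cast_pos.2 (NeZero.pos m)
  have h := Finset.expect_le_expect (s := Finset.univ) fun l _ =>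
    Finset.expect_le_expect (s := Finset.univ) fun (y : E → Fin m) _ =>
      expect_positivePart_ge (m := m) hrk hf hα hLα hLq l y
  refine le_trans ?_ h
  simp only [Finset.expect_add_distrib, Finset.expect_sub_distrib, ← Finset.mul_expect,
    Finset.expect_const Finset.univ_nonempty]
  have h1 := greedyGain_le_indep (m := m) (M := M) hrk hf
  have h2 := expect_loss_le (m := m) (M := M) hrk hf
  have h3 : greedyGain M f rk m / ((m + 1) * α) ≤ 1 / α * 𝔼 l, 𝔼 y : E → Fin m,
      ∑ u ∈ (finish (oracle M f rk) l y).indep, weight (oracle M f rk) l y u := by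
    rw [div_le_iff₀ (by positivity)]
    refine h1.trans (le_of_eq ?_)
    unfold weight
    field_simp
  have h4 : q * 𝔼 l, 𝔼 y : E → Fin m, fullTotal (oracle M f rk) l y
      (fun u t => if l u = false ∧ active y u then loss f u t else 0) ≤
      q * (2 * greedyGain M f rk m + f ∅) / (m * (m + 1)) := by
    rw [mul_div_assoc]
    refine mul_le_mul_of_nonneg_left ?_ hq
    rw [le_div_iff₀ (by positivity), mul_comm]
    exact h2
  linarith

/-- Put `x = qα`. From `m ≥ 4x` the loss takes at most half of the gain, and from `m ≤ 4x + 1` one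
gets `24(3x+1)/(m+1) ≥ 12`. The coefficient of `W` is thus at least 6, and that of `z` is at least
12. -/
theorem competitive_arith {z W α q : ℝ} {m : ℕ} (hz : 0 ≤ z) (hW : 0 ≤ W) (hα : 1 ≤ α)
    (hq0 : 0 < q) (hq1 : q ≤ 1) (hm0 : 0 < m) (hm : 4 * (q * α) ≤ m) (hm' : m ≤ 4 * (q * α) + 1) :
    2 * z + 6 * W ≤ 24 * α * (3 * q * α + 1) *
      (z + W / ((m + 1) * α) - q * (2 * W + z) / (m * (m + 1))) := by
  have hm1 : (1 : ℝ) ≤ m := by exact_mod_cast hm0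
  have hmpos : (0 : ℝ) < m := by linarith
  have hx : 0 < q * α := by positivity
  have hsplit : 24 * α * (3 * q * α + 1) *
      (z + W / ((m + 1) * α) - q * (2 * W + z) / (m * (m + 1))) =
      24 * α * (3 * q * α + 1) * (1 - q / (m * (m + 1))) * z +
      24 * (3 * (q * α) + 1) / (m + 1) * (1 - 2 * (q * α) / m) * W := by
    field_simp
    ring
  rw [hsplit]
  have h1 : q / (m * (m + 1)) ≤ 1 / 2 := by
    rw [div_le_div_iff₀ (by positivity) (by norm_num)]
    nlinarith
  have h2 : 2 * (q * α) / m ≤ 1 / 2 := by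
    rw [div_le_div_iff₀ hmpos (by norm_num)]
    linarith
  have h3 : 12 ≤ 24 * (3 * (q * α) + 1) / ((m : ℝ) + 1) := by
    rw [le_div_iff₀ (by positivity)]
    linarith
  have h4 : 24 ≤ 24 * α * (3 * q * α + 1) := by nlinarith
  have h5 : 2 ≤ 24 * α * (3 * q * α + 1) * (1 - q / (m * (m + 1))) := by nlinarith
  have h6 : 6 ≤ 24 * (3 * (q * α) + 1) / ((m : ℝ) + 1) * (1 - 2 * (q * α) / m) := by nlinarith
  nlinarith

end Value

/-! ### The online policy and its simulated arrival order. -/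

section Policy

/-- The sorting key of the position `j` of the simulated arrival order: the sampled positions
come first. -/
def key {n : ℕ} (l : Fin n → Bool) (j : Fin n) : ℕ := if l j then j else n + j

theorem key_injective {n : ℕ} (l : Fin n → Bool) : Function.Injective (key l) := by
  intro i j h
  have := i.isLt
  have := j.isLt
  unfold key at h
  split_ifs at h <;> ext <;> omega

/-- The position in the simulated arrival order of the `i`-th arriving element. -/
def simulatedPos {n : ℕ} (l : Fin n → Bool) : Equiv.Perm (Fin n) := Tuple.sort (key l)

/-- Real arrival times follow the keys. This is used to show that the required elements have already
arrived. -/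
theorem simulatedPos_symm_le {n : ℕ} {l : Fin n → Bool} {j j' : Fin n} (h : key l j' ≤ key l j) :
    (simulatedPos l).symm j' ≤ (simulatedPos l).symm j := by
  by_contra hlt
  push Not at hlt
  have h1 := Tuple.monotone_sort (key l) hlt.le
  simp only [Function.comp_apply] at h1
  change key l (simulatedPos l ((simulatedPos l).symm j)) ≤
    key l (simulatedPos l ((simulatedPos l).symm j')) at h1
  rw [Equiv.apply_symm_apply, Equiv.apply_symm_apply] at h1
  have := key_injective l (le_antisymm h1 h)
  rw [this] at hlt
  exact lt_irrefl _ hlt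

/-- The random choices made before the first arrival: which positions of the simulated order are
sampled, which of the others may become active, and the ranking that breaks ties. -/
structure Seed (n m : ℕ) where
  sampled : Fin n → Bool
  mark : Fin n → Fin m
  ranking : Equiv.Perm (Fin n)

/-- A seed is a triple. -/
def Seed.equiv (n m : ℕ) :
    Seed n m ≃ (Fin n → Bool) × (Fin n → Fin m) × Equiv.Perm (Fin n) where
  toFun d := (d.sampled, d.mark, d.ranking)
  invFun d := ⟨d.1, d.2.1, d.2.2⟩
  left_inv _ := rfl
  right_inv _ := rfl

instance (n m : ℕ) : Fintype (Seed n m) := Fintype.ofEquiv _ (Seed.equiv n m).symm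
instance (n m : ℕ) [NeZero m] : Nonempty (Seed n m) := ⟨fun _ => false, 0, 1⟩
instance (n m : ℕ) : MeasurableSpace (Seed n m) := ⊤
instance (n m : ℕ) : MeasurableSingletonClass (Seed n m) := ⟨fun _ => trivial⟩

theorem measurable_from_finite_prod {D Ω β : Type*} [MeasurableSpace D] [MeasurableSpace Ω]
    [MeasurableSpace β] [Finite D] [MeasurableSingletonClass D] {F : D × Ω → β}
    (hF : ∀ d, Measurable fun ω => F (d, ω)) : Measurable F :=
  measurable_from_prod_countable_right hF

variable {n m : ℕ} [NeZero m]

/-- The position `j`, or the last position if `j` has not yet arrived. -/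
def clamp {n : ℕ} (i j : Fin n) : Fin (i + 1) := ⟨min j i, by omega⟩

/-- The oracle of the elements that have arrived. -/
def arrivedOracle (d : Seed n m) (i : Fin n) (indep : Finset (Fin (i + 1)) → Prop)
    (value : Finset (Fin (i + 1)) → ℝ) : Oracle (Fin (i + 1)) where
  ind := indep
  val := value
  rank v := d.ranking (Fin.castLE i.isLt v)

/-- Whether the element in position `v` is sampled. -/
def sampledAt (d : Seed n m) (i : Fin n) (v : Fin (i + 1)) : Bool :=
  d.sampled (simulatedPos d.sampled (Fin.castLE i.isLt v))

/-- The weight of an element that has arrived, in the derived linear instance. -/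
noncomputable def arrivedWeight (d : Seed n m) (i : Fin n) (indep : Finset (Fin (i + 1)) → Prop)
    (value : Finset (Fin (i + 1)) → ℝ) (v : Fin (i + 1)) : ℝ :=
  if sampledAt d i v = false ∧ d.mark (simulatedPos d.sampled (Fin.castLE i.isLt v)) = 0 then
    (arrivedOracle d i indep value).gain (sampledAt d i) n
      (insert v (Finset.univ.filter fun v => sampledAt d i v)) v
  else 0

/-- The arrived position of the element in position `j'` of the simulated order. -/
def realPos (d : Seed n m) (i : Fin n) (j' : Fin (simulatedPos d.sampled i + 1)) : Fin (i + 1) :=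
  clamp i ((simulatedPos d.sampled).symm (Fin.castLE (simulatedPos d.sampled i).isLt j'))

open Classical in
/-- The policy that simulates the linear policy `P` on the derived linear instance. -/
noncomputable def policy (P : OnlinePolicy.{u} n) (m : ℕ) [NeZero m] : OnlinePolicy.{u} n where
  Ω := Seed n m × P.Ω
  law := (PMF.uniformOfFintype (Seed n m)).toMeasure.prod P.law
  accept i ω indep value :=
    -- Sampled elements are rejected whatever the simulated policy says. Only for them can part of
    -- the simulated prefix still be missing, so the clamped answers are never relied upon.
    decide (sampledAt ω.1 i (Fin.last i) = false ∧
      0 < arrivedWeight ω.1 i indep value (Fin.last i)) &&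
    P.accept (simulatedPos ω.1.sampled i) ω.2
      (fun S => indep (S.image (realPos ω.1 i)))
      (fun S => ∑ v ∈ S.image (realPos ω.1 i), arrivedWeight ω.1 i indep value v)
  measurable_accept i indep value := by
    refine measurable_from_finite_prod fun d => ?_
    exact (measurable_of_finite fun b : Bool =>
      decide (sampledAt d i (Fin.last i) = false ∧
        0 < arrivedWeight d i indep value (Fin.last i)) && b).comp
      (P.measurable_accept (simulatedPos d.sampled i)
        (fun S => indep (S.image (realPos d i)))
        (fun S => ∑ v ∈ S.image (realPos d i), arrivedWeight d i indep value v))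

/-- The algorithm for submodular objectives derived from the algorithm `Lin` for linear ones. -/
noncomputable def reduction (Lin : OnlineAlgorithm.{u}) (m : ℕ) [NeZero m] : OnlineAlgorithm.{u} :=
  fun n => policy (Lin n) m

end Policy

/-! ### Correctness of the simulation. -/

section Simulation

variable {E : Type v} [Fintype E] {m : ℕ}

/-- The simulated arrival order. -/
def simulatedOrder (d : Seed (Fintype.card E) m) (σ : ArrivalOrder E) : ArrivalOrder E :=
  (simulatedPos d.sampled).symm.trans σ

/-- The ranking of the elements. -/
def elementRank (κ : E ≃ Fin (Fintype.card E)) (e : E) : ℕ := κ e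

theorem elementRank_injective (κ : E ≃ Fin (Fintype.card E)) :
    Function.Injective (elementRank κ) := fun _ _ h => κ.injective (Fin.ext h)

/-- The elements that have arrived. -/
def arrivedEmb (σ : ArrivalOrder E) (i : Fin (Fintype.card E)) : Fin (i + 1) ↪ E :=
  (Fin.castLEEmb (Nat.succ_le_of_lt i.isLt)).trans σ.toEmbedding

theorem mem_output {A : OnlineAlgorithm.{u}} {M : Matroid E} {f : Finset E → ℝ}
    {σ : ArrivalOrder E} {ω : (A (Fintype.card E)).Ω} (i : Fin (Fintype.card E)) :
    σ i ∈ A.output M f σ ω ↔ (A (Fintype.card E)).accept i ω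
      (fun S => M.Indep (arrivedSet σ i S : Set E)) (fun S => f (arrivedSet σ i S)) = true := by
  simp [OnlineAlgorithm.output]

variable (M : Matroid E) (f : Finset E → ℝ) (σ : ArrivalOrder E)
  (d : Seed (Fintype.card E) m)

/-- At an unsampled position every simulated predecessor has a smaller key, being sampled or
earlier, so it has arrived and clamping has no effect. -/
theorem map_image_realPos {i : Fin (Fintype.card E)} (hi : sampledAt d i (Fin.last i) = false)
    (S : Finset (Fin (simulatedPos d.sampled i + 1))) :
    (S.image (realPos d i)).map (arrivedEmb σ i) =
      arrivedSet (simulatedOrder d σ) (simulatedPos d.sampled i) S := by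
  classical
  unfold arrivedSet
  rw [Finset.map_eq_image, Finset.map_eq_image, Finset.image_image]
  refine Finset.image_congr fun j' _ => ?_
  have hle : (simulatedPos d.sampled).symm
      (Fin.castLE (simulatedPos d.sampled i).isLt j') ≤ i := by
    have hk : key d.sampled (Fin.castLE (simulatedPos d.sampled i).isLt j') ≤
        key d.sampled (simulatedPos d.sampled i) := by
      have h2 : d.sampled (simulatedPos d.sampled i) = false := hi
      have := j'.isLt
      unfold key
      rw [h2]
      simp only [Bool.false_eq_true, if_false, Fin.val_castLE]
      split_ifs <;> omega
    simpa using simulatedPos_symm_le hk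
  change σ _ = σ _
  congr 1
  ext
  simp only [realPos, clamp]
  exact min_eq_left (by exact_mod_cast hle)

variable [DecidableEq E] [NeZero m]

/-- Once an unsampled element arrives the whole sample is known, so `gain_restrict` and transport
along the arrived positions identify the two gains. -/
theorem arrivedWeight_eq {i : Fin (Fintype.card E)} (hi : sampledAt d i (Fin.last i) = false)
    (v : Fin (i + 1)) :
    arrivedWeight d i (fun S => M.Indep (arrivedSet σ i S : Set E))
      (fun S => f (arrivedSet σ i S)) v =
    weight (oracle M f (elementRank (σ.symm.trans d.ranking)))
      (fun e => d.sampled ((simulatedOrder d σ).symm e))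
      (fun e => d.mark ((simulatedOrder d σ).symm e)) (arrivedEmb σ i v) := by
  have hτ : ∀ i', (simulatedOrder d σ).symm (σ i') = simulatedPos d.sampled i' := by
    intro i'; simp [simulatedOrder]
  have hφ : ∀ v, arrivedEmb σ i v = σ (Fin.castLE i.isLt v) := fun v => rfl
  set O := oracle M f (elementRank (σ.symm.trans d.ranking)) with hO
  set lE : E → Bool := fun e => d.sampled ((simulatedOrder d σ).symm e) with hlE
  have hl : ∀ a, sampledAt d i a = lE (arrivedEmb σ i a) := by
    intro a; simp only [hlE, hφ, hτ]; rfl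
  unfold arrivedWeight weight
  have hcond : (sampledAt d i v = false ∧
      d.mark (simulatedPos d.sampled (Fin.castLE i.isLt v)) = 0) ↔
      (lE (arrivedEmb σ i v) = false ∧
        active (fun e => d.mark ((simulatedOrder d σ).symm e)) (arrivedEmb σ i v)) := by
    rw [hl]; simp [active, hφ, hτ]
  by_cases hc : sampledAt d i v = false ∧
      d.mark (simulatedPos d.sampled (Fin.castLE i.isLt v)) = 0
  · rw [if_pos hc, if_pos (hcond.1 hc)]
    have hlv := (hcond.1 hc).1
    rw [Oracle.gain_restrict (O := O) (elementRank_injective _) hlv (Finset.mem_univ _)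
      Finset.card_univ.le]
    have hR : insert (arrivedEmb σ i v) (Finset.univ.filter fun e => lE e) =
        (insert v (Finset.univ.filter fun v => sampledAt d i v)).map (arrivedEmb σ i) := by
      rw [Finset.map_insert]
      congr 1
      ext e
      simp only [Finset.mem_filter, Finset.mem_univ, true_and, Finset.mem_map]
      constructor
      · intro he
        obtain ⟨i', rfl⟩ := σ.surjective e
        have hle : i' ≤ i := by
          have hk : key d.sampled (simulatedPos d.sampled i') ≤
              key d.sampled (simulatedPos d.sampled i) := by
            have h1 : d.sampled (simulatedPos d.sampled i') = true := by
              simpa only [hlE, hτ] using he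
            have h2 : d.sampled (simulatedPos d.sampled i) = false := hi
            unfold key
            rw [h1, h2]
            simp only [if_true, Bool.false_eq_true, if_false]
            omega
          simpa using simulatedPos_symm_le hk
        refine ⟨⟨i', Nat.lt_succ_of_le hle⟩, ?_, rfl⟩
        rw [hl]
        exact he
      · rintro ⟨a, ha, rfl⟩
        rw [← hl]
        exact ha
    rw [hR]
    symm
    exact Oracle.gain_map (O' := O) (arrivedEmb σ i) (fun S => Iff.rfl) (fun S => rfl)
      (fun a => by simp [arrivedOracle, hO, oracle, elementRank, hφ])
      (elementRank_injective _) hl v _ _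
  · rw [if_neg hc, if_neg (fun h => hc (hcond.2 h))]

theorem output_reduction (Lin : OnlineAlgorithm.{u}) (ω : (Lin (Fintype.card E)).Ω) :
    (reduction Lin m).output M f σ (d, ω) =
      positivePart (oracle M f (elementRank (σ.symm.trans d.ranking)))
        (fun e => d.sampled ((simulatedOrder d σ).symm e))
        (fun e => d.mark ((simulatedOrder d σ).symm e))
        (Lin.output M (linearObjective (weight (oracle M f (elementRank (σ.symm.trans d.ranking)))
          (fun e => d.sampled ((simulatedOrder d σ).symm e))
          (fun e => d.mark ((simulatedOrder d σ).symm e)))) (simulatedOrder d σ) ω) := by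
  classical
  set O := oracle M f (elementRank (σ.symm.trans d.ranking)) with hO
  set w := weight O (fun e => d.sampled ((simulatedOrder d σ).symm e))
          (fun e => d.mark ((simulatedOrder d σ).symm e)) with hw
  ext e
  obtain ⟨i, rfl⟩ := σ.surjective e
  have hτ : σ i = simulatedOrder d σ (simulatedPos d.sampled i) := by simp [simulatedOrder]
  have hL := mem_output (A := Lin) (M := M) (f := linearObjective w) (σ := simulatedOrder d σ)
    (ω := ω) (simulatedPos d.sampled i)
  rw [← hτ] at hL
  refine (mem_output (A := reduction Lin m) i).trans
    (Iff.trans ?_ (Finset.mem_filter.trans (and_congr_left' hL)).symm)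
  change _ ↔ _ ∧ 0 < w (σ i)
  have hlast : arrivedEmb σ i (Fin.last i) = σ i := rfl
  simp only [reduction, policy, Bool.and_eq_true, decide_eq_true_eq]
  by_cases hi : sampledAt d i (Fin.last i) = false
  · have hwt := arrivedWeight_eq M f σ d hi
    simp only [hwt]
    rw [← hO, ← hw, hlast]
    have hind : ∀ S, arrivedSet σ i (S.image (realPos d i)) =
        arrivedSet (simulatedOrder d σ) (simulatedPos d.sampled i) S :=
      map_image_realPos σ d hi
    have hval : ∀ S : Finset (Fin (simulatedPos d.sampled i + 1)),
        ∑ v ∈ S.image (realPos d i), w (arrivedEmb σ i v) =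
        linearObjective w (arrivedSet (simulatedOrder d σ) (simulatedPos d.sampled i) S) := by
      intro S
      rw [← map_image_realPos σ d hi, linearObjective, Finset.sum_map]
    simp only [hind, hval, hi, true_and]
    exact and_comm
  · have h1 : ¬ 0 < w (σ i) := by
      intro h
      have := (weight_pos h).1
      rw [hτ, Equiv.symm_apply_apply] at this
      exact hi this
    simp [hi, h1]

theorem integral_uniform_prod {D : Type*} [Fintype D] [Nonempty D] [MeasurableSpace D]
    [MeasurableSingletonClass D] {Ω : Type*} [MeasurableSpace Ω] (μ : Measure Ω)
    [IsProbabilityMeasure μ] {F : D × Ω → ℝ}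
    (hF : Integrable F ((PMF.uniformOfFintype D).toMeasure.prod μ)) :
    ∫ x, F x ∂((PMF.uniformOfFintype D).toMeasure.prod μ) = 𝔼 d, ∫ ω, F (d, ω) ∂μ := by
  rw [integral_prod _ hF, PMF.integral_eq_sum, Fintype.expect_eq_sum_div_card, Finset.sum_div]
  refine Finset.sum_congr rfl fun d _ => ?_
  simp [PMF.uniformOfFintype_apply, div_eq_inv_mul]

/-- The expected value of the derived algorithm: the simulated order, the sampled elements, the
marks and the ranking are independent and uniform. -/
theorem expectedValue_reduction (Lin : OnlineAlgorithm.{u}) :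
    (reduction Lin m).expectedValue M f =
      𝔼 κ : E ≃ Fin (Fintype.card E), 𝔼 l, 𝔼 y : E → Fin m, 𝔼 τ : ArrivalOrder E,
        ∫ ω, f (positivePart (oracle M f (elementRank κ)) l y
        (Lin.output M (linearObjective (weight (oracle M f (elementRank κ)) l y)) τ ω))
        ∂(Lin (Fintype.card E)).law := by
  set Φ : (E ≃ Fin (Fintype.card E)) → (E → Bool) → (E → Fin m) → ArrivalOrder E → ℝ :=
    fun κ l y τ => ∫ ω, f (positivePart (oracle M f (elementRank κ)) l y
        (Lin.output M (linearObjective (weight (oracle M f (elementRank κ)) l y)) τ ω))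
        ∂(Lin (Fintype.card E)).law with hΦ
  rw [expectedValue_eq]
  have h1 : ∀ σ : ArrivalOrder E, ∫ ω, f ((reduction Lin m).output M f σ ω)
      ∂((reduction Lin m) (Fintype.card E)).law =
      𝔼 l : Fin (Fintype.card E) → Bool, 𝔼 y : Fin (Fintype.card E) → Fin m,
        𝔼 ρ : Equiv.Perm (Fin (Fintype.card E)),
        Φ (σ.symm.trans ρ) (fun e => l (((simulatedPos l).symm.trans σ).symm e))
          (fun e => y (((simulatedPos l).symm.trans σ).symm e))
          ((simulatedPos l).symm.trans σ) := by
    intro σ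
    refine (integral_uniform_prod _ (integrable_output (reduction Lin m) M f σ f)).trans ?_
    refine (Fintype.expect_equiv (Seed.equiv _ m) _ (fun d =>
      Φ (σ.symm.trans d.2.2) (fun e => d.1 (((simulatedPos d.1).symm.trans σ).symm e))
          (fun e => d.2.1 (((simulatedPos d.1).symm.trans σ).symm e))
          ((simulatedPos d.1).symm.trans σ)) fun d => ?_).trans ?_
    · exact integral_congr_ae (Filter.Eventually.of_forall fun ω =>
        congrArg f (output_reduction M f σ d Lin ω))
    rw [← Finset.univ_product_univ, Finset.expect_product]
    refine Finset.expect_congr rfl fun l _ => ?_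
    rw [← Finset.univ_product_univ, Finset.expect_product]
  -- For fixed `σ` and `l`, marks and ranking are relabelled from positions to elements. Composing
  -- with the random permutation makes the tie-breaking independent of the arrival order.
  have h2 : ∀ (σ : ArrivalOrder E) (l : Fin (Fintype.card E) → Bool),
      𝔼 y : Fin (Fintype.card E) → Fin m, 𝔼 ρ : Equiv.Perm (Fin (Fintype.card E)),
        Φ (σ.symm.trans ρ) (fun e => l (((simulatedPos l).symm.trans σ).symm e))
          (fun e => y (((simulatedPos l).symm.trans σ).symm e))
          ((simulatedPos l).symm.trans σ) =
      𝔼 y : E → Fin m, 𝔼 κ : E ≃ Fin (Fintype.card E),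
        Φ κ (fun e => l (((simulatedPos l).symm.trans σ).symm e)) y
          ((simulatedPos l).symm.trans σ) := by
    intro σ l
    refine Fintype.expect_equiv (((simulatedPos l).symm.trans σ).arrowCongr (Equiv.refl _)) _ _
      fun y => ?_
    exact Fintype.expect_equiv (σ.equivCongr (Equiv.refl _)) _ _ fun ρ => rfl
  simp only [h1, h2]
  rw [Finset.expect_comm]
  -- For fixed `l` the simulated order is a fixed rearrangement of a uniform order, hence uniform.
  have h3 : ∀ l : Fin (Fintype.card E) → Bool,
      𝔼 σ : ArrivalOrder E, 𝔼 y : E → Fin m, 𝔼 κ : E ≃ Fin (Fintype.card E),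
        Φ κ (fun e => l (((simulatedPos l).symm.trans σ).symm e)) y
          ((simulatedPos l).symm.trans σ) =
      𝔼 τ : ArrivalOrder E, 𝔼 y : E → Fin m, 𝔼 κ : E ≃ Fin (Fintype.card E),
        Φ κ (fun e => l (τ.symm e)) y τ := fun l =>
    Fintype.expect_equiv ((simulatedPos l).equivCongr (Equiv.refl _)) _ _ fun σ => rfl
  simp only [h3]
  rw [Finset.expect_comm]
  -- The sample was drawn on simulated positions, so for fixed `τ` it is a uniform sample of
  -- elements: sample and simulated order are independent.
  have h4 : ∀ τ : ArrivalOrder E,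
      𝔼 l : Fin (Fintype.card E) → Bool, 𝔼 y : E → Fin m, 𝔼 κ : E ≃ Fin (Fintype.card E),
        Φ κ (fun e => l (τ.symm e)) y τ =
      𝔼 l : E → Bool, 𝔼 y : E → Fin m, 𝔼 κ : E ≃ Fin (Fintype.card E), Φ κ l y τ := fun τ =>
    Fintype.expect_equiv (τ.arrowCongr (Equiv.refl _)) _ _ fun l => rfl
  simp only [h4]
  calc 𝔼 τ : ArrivalOrder E, 𝔼 l, 𝔼 y : E → Fin m, 𝔼 κ, Φ κ l y τ
      = 𝔼 τ : ArrivalOrder E, 𝔼 κ, 𝔼 l, 𝔼 y : E → Fin m, Φ κ l y τ := by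
        refine Finset.expect_congr rfl fun τ _ => ?_
        exact (Finset.expect_congr rfl fun l _ => Finset.expect_comm _ _ _).trans
          (Finset.expect_comm _ _ _)
    _ = 𝔼 κ, 𝔼 τ : ArrivalOrder E, 𝔼 l, 𝔼 y : E → Fin m, Φ κ l y τ := Finset.expect_comm _ _ _
    _ = 𝔼 κ, 𝔼 l, 𝔼 y : E → Fin m, 𝔼 τ : ArrivalOrder E, Φ κ l y τ := by
        refine Finset.expect_congr rfl fun κ _ => ?_
        exact (Finset.expect_comm _ _ _).trans
          (Finset.expect_congr rfl fun l _ => Finset.expect_comm _ _ _)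

end Simulation

/-! ### Independence of the output and the competitive ratio. -/

theorem isSMSPAlgorithm_reduction {Lin : OnlineAlgorithm.{u}} (hLin : IsMSPAlgorithm.{u, v} Lin)
    (m : ℕ) [NeZero m] : IsSMSPAlgorithm.{u, v} (reduction Lin m) := by
  intro E _ _ M hM f _ σ ω
  obtain ⟨d, ω⟩ := ω
  rw [output_reduction]
  have h := hLin E M hM _ (weight_nonneg (O := oracle M f (elementRank (σ.symm.trans d.ranking)))
    (elementRank_injective _) (fun e => d.sampled ((simulatedOrder d σ).symm e))
    (fun e => d.mark ((simulatedOrder d σ).symm e))) (simulatedOrder d σ) ω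
  exact h.subset (Finset.coe_subset.2 (Finset.filter_subset _ _))

/-- Tested on the weight concentrated at `e`: the algorithm must pick `e` with probability at least
`1/α`, yet picks it with probability at most `q`. -/
theorem one_le_of_isNonloop {E : Type v} [Fintype E] [DecidableEq E] {M : Matroid E}
    {Lin : OnlineAlgorithm.{u}} {α q : ℝ} (hα : 0 ≤ α) (hLα : Lin.MSPCompetitive M α)
    (hLq : Lin.MSPSelectionBound M q) {e : E} (he : M.IsNonloop e) : 1 ≤ α * q := by
  have hw : ∀ u, (0 : ℝ) ≤ if u = e then 1 else 0 := fun u => by split_ifs <;> norm_num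
  have h := hLα (fun u => if u = e then 1 else 0) hw {e} (by simpa using he.indep)
  rw [expectedValue_linearObjective] at h
  simp only [ite_mul, one_mul, zero_mul, Finset.sum_ite_eq', Finset.mem_univ, if_true] at h
  have h1 : linearObjective (fun u => if u = e then (1 : ℝ) else 0) {e} = 1 := by
    simp [linearObjective]
  rw [h1] at h
  exact h.trans (mul_le_mul_of_nonneg_left (hLq _ hw e) hα)

theorem smspCompetitive_reduction {E : Type v} [Fintype E] [DecidableEq E] {M : Matroid E}
    {Lin : OnlineAlgorithm.{u}} {α q : ℝ} (hα : 1 ≤ α) (hq0 : 0 < q) (hq1 : q ≤ 1)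
    (hLα : Lin.MSPCompetitive M α) (hLq : Lin.MSPSelectionBound M q) {m : ℕ} [NeZero m]
    (hm : 4 * (q * α) ≤ m) (hm' : m ≤ 4 * (q * α) + 1) :
    (reduction Lin m).SMSPCompetitive M (24 * α * (3 * q * α + 1)) := by
  intro f hf T hT
  have hC : 0 ≤ 24 * α * (3 * q * α + 1) := by positivity
  rw [expectedValue_reduction, Finset.mul_expect,
    ← Finset.expect_const ⟨Fintype.equivFin E, Finset.mem_univ _⟩ (f T)]
  refine Finset.expect_le_expect fun κ _ => ?_
  have hrk := elementRank_injective κ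
  calc f T ≤ 2 * f ∅ + 6 * greedyGain M f (elementRank κ) m := val_le_greedyGain hrk hf hT
    _ ≤ _ := competitive_arith (hf.nonneg ∅) (greedyGain_nonneg hrk) hα hq0 hq1 (NeZero.pos m) hm hm'
    _ ≤ _ := mul_le_mul_of_nonneg_left
      (expect_positivePart_ge' hrk hf (by linarith) hq0.le hLα hLq) hC

end SubmodularSecretary

theorem theorem3 (Linear : OnlineAlgorithm.{u}) (hLinear : IsMSPAlgorithm.{u, v} Linear)
    (α q : ℝ) (hα : 1 ≤ α) (hq0 : 0 < q) (hq1 : q ≤ 1) :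
    ∃ A : OnlineAlgorithm.{u}, IsSMSPAlgorithm.{u, v} A ∧
      ∀ (E : Type v) [Fintype E] [DecidableEq E] (M : Matroid E), M.E = Set.univ →
        Linear.MSPCompetitive M α → Linear.MSPSelectionBound M q →
          A.SMSPCompetitive M (24 * α * (3 * q * α + 1)) ∧
          ((∃ e, M.IsNonloop e) → 24 * α * (3 * q * α + 1) ≤ 96 * (q * α ^ 2)) := by
  have hx : 0 < 4 * (q * α) := by positivity
  -- The parameter is `m = ⌈4qα⌉`, the least for which the loss is at most half of the gain in
  -- `competitive_arith`.
  have : NeZero ⌈4 * (q * α)⌉₊ := ⟨(Nat.ceil_pos.2 hx).ne'⟩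
  refine ⟨SubmodularSecretary.reduction Linear ⌈4 * (q * α)⌉₊,
    SubmodularSecretary.isSMSPAlgorithm_reduction hLinear _, fun E _ _ M _ hLα hLq => ⟨?_, ?_⟩⟩
  · exact SubmodularSecretary.smspCompetitive_reduction hα hq0 hq1 hLα hLq (Nat.le_ceil _)
      (Nat.ceil_lt_add_one hx.le).le
  · rintro ⟨e, he⟩
    have := SubmodularSecretary.one_le_of_isNonloop (by linarith) hLα hLq he
    -- Since `qα ≥ 1`, the factor `3qα + 1` is at most `4qα`.
    nlinarith
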